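/- Let $\mathbb{K}$ be $\mathbb{R}$ or $\mathbb{C}$, and let $X$ and $Y$ be compact Hausdorff spaces. Let $\mathcal{E}$ and $\mathcal{F}$ be Banach bundles over $X$ (locally trivial bundles with fibres isomorphic to a fixed Banach space over $\mathbb{K}$ and norm-continuous linear transition functions), and let $L\colon\mathcal{E}\to\mathcal{F}$ be a Fredholm morphism, i.e. a family of bounded operators $L_\lambda\colon\mathcal{E}_\lambda\to\mathcal{F}_\lambda$, $\lambda\in X$, which is norm-continuous in local trivialisations and such that every $L_\lambda$ is a Fredholm operator. Let $K(X)$ denote the Grothendieck group of isomorphism classes of finite-dimensional $\mathbb{K}$-vector bundles over $X$ (so $KO(X)$ if $\mathbb{K}=\mathbb{R}$). A finite-dimensional subbundle $\mathcal{V}\subset\mathcal{F}$ is called transversal to $L$ if $\operatorname{im}(L_\lambda)+\mathcal{V}_\lambda=\mathcal{F}_\lambda$ for all $\lambda\in X$; in this case $E(L,\mathcal{V})\subset\mathcal{E}$ denotes the vector bundle with fibres $\{u\in\mathcal{E}_\lambda: L_\lambda u\in\mathcal{V}_\lambda\}$, and the index bundle of $L$ is $$\operatorname{ind}(L)=[E(L,\mathcal{V})]-[\mathcal{V}]\in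 K(X).$$ Then the index bundle is well defined: such a $\mathcal{V}$ exists, and the element $[E(L,\mathcal{V})]-[\mathcal{V}]$ does not depend on its choice. Moreover (naturality), for every continuous map $f\colon Y\to X$, with pullback morphism $f^*L\colon f^*\mathcal{E}\to f^*\mathcal{F}$, $(f^*L)_y=L_{f(y)}$, $$\operatorname{ind}(f^*L)=f^*\operatorname{ind}(L)\in K(Y).$$ Consequently, if $f,g\colon Y\to X$ are homotopic continuous maps, then $\operatorname{ind}(f^*L)=\operatorname{ind}(g^*L)\in K(Y)$. -/

import Mathlib

open Topology Bundle

universe u v w v' w' u'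

/-- A quasi-vector bundle over `X`: a family of `𝕜`-vector spaces `Fib x`, `x : X`, with a topology
on the total space `Σ x, Fib x` for which the projection to `X` is continuous.  No local triviality
is required.  (A module over a field is automatically an additive group.) -/
structure QuasiBundle (𝕜 : Type u) [RCLike 𝕜] (X : Type w) [TopologicalSpace X] where
  Fib : X → Type v
  [addCommMonoid : ∀ x, AddCommMonoid (Fib x)]
  [module : ∀ x, Module 𝕜 (Fib x)]
  top : TopologicalSpace (Sigma Fib)
  continuous_fst : Continuous[top, _] (Sigma.fst : Sigma Fib → X)

namespace QuasiBundle

theorem continuous_comp_induced {A B C : Type*} [TopologicalSpace B] [tC : TopologicalSpace C]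
    (i : A → B) {j : B → C} (hj : Continuous j) :
    Continuous[TopologicalSpace.induced i inferInstance, tC] (fun a => j (i a)) :=
  @Continuous.comp _ _ _ (TopologicalSpace.induced i inferInstance) _ _ _ _ hj
    continuous_induced_dom

attribute [instance] QuasiBundle.addCommMonoid QuasiBundle.module

section Basic

variable {𝕜 : Type u} [RCLike 𝕜] {X : Type w} [TopologicalSpace X]

/-- The total space. -/
def Total (Q : QuasiBundle.{u, v, w} 𝕜 X) : Type (max w v) := Sigma Q.Fib

instance (Q : QuasiBundle.{u, v, w} 𝕜 X) : TopologicalSpace Q.Total := Q.top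

/-- The bundle projection. -/
def proj {Q : QuasiBundle.{u, v, w} 𝕜 X} (p : Q.Total) : X := p.1

theorem continuous_proj (Q : QuasiBundle.{u, v, w} 𝕜 X) :
    Continuous (proj : Q.Total → X) := Q.continuous_fst

/-- The point of the total space given by a vector in the fibre over `x`. -/
def pt (Q : QuasiBundle.{u, v, w} 𝕜 X) (x : X) (a : Q.Fib x) : Q.Total := ⟨x, a⟩

/-- The map of total spaces covering the identity that is given by fibrewise maps. -/
def totalMap {Q : QuasiBundle.{u, v, w} 𝕜 X} {R : QuasiBundle.{u, v', w} 𝕜 X}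
    (φ : ∀ x, Q.Fib x → R.Fib x) (p : Q.Total) : R.Total := ⟨p.1, φ p.1 p.2⟩

/-- An isomorphism over `X`: fibrewise linear isomorphisms that form a homeomorphism of the total
spaces. -/
structure Iso (Q : QuasiBundle.{u, v, w} 𝕜 X) (R : QuasiBundle.{u, v', w} 𝕜 X) where
  equiv : ∀ x, Q.Fib x ≃ₗ[𝕜] R.Fib x
  continuous_equiv : Continuous (totalMap (fun x => equiv x) : Q.Total → R.Total)
  continuous_symm : Continuous (totalMap (fun x => (equiv x).symm) : R.Total → Q.Total)

/-- The identity isomorphism. -/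
def Iso.refl (Q : QuasiBundle.{u, v, w} 𝕜 X) : Iso Q Q where
  equiv x := LinearEquiv.refl 𝕜 (Q.Fib x)
  continuous_equiv := continuous_id
  continuous_symm := continuous_id

/-- The inverse isomorphism. -/
def Iso.symm {Q : QuasiBundle.{u, v, w} 𝕜 X} {R : QuasiBundle.{u, v', w} 𝕜 X} (e : Iso Q R) :
    Iso R Q where
  equiv x := (e.equiv x).symm
  continuous_equiv := e.continuous_symm
  continuous_symm := e.continuous_equiv

/-- The composition of isomorphisms. -/
def Iso.trans {Q : QuasiBundle.{u, v, w} 𝕜 X} {R : QuasiBundle.{u, v', w} 𝕜 X}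
    {S : QuasiBundle.{u, w', w} 𝕜 X} (e : Iso Q R) (e' : Iso R S) : Iso Q S where
  equiv x := (e.equiv x).trans (e'.equiv x)
  continuous_equiv := e'.continuous_equiv.comp e.continuous_equiv
  continuous_symm := e.continuous_symm.comp e'.continuous_symm

/-- The product bundle `X × W`. -/
abbrev trivial (𝕜 : Type u) [RCLike 𝕜] (X : Type w) [TopologicalSpace X] (W : Type v)
    [AddCommMonoid W] [Module 𝕜 W] [TopologicalSpace W] : QuasiBundle.{u, v, w} 𝕜 X where
  Fib := fun _ => W
  top := TopologicalSpace.induced (fun p => ((p.1, p.2) : X × W)) inferInstance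
  continuous_fst :=
    continuous_comp_induced (fun p : (Σ _ : X, W) => ((p.1, p.2) : X × W)) _root_.continuous_fst

/-- The direct (Whitney) sum; the total space is the fibre product of the total spaces. -/
abbrev sum (Q : QuasiBundle.{u, v, w} 𝕜 X) (R : QuasiBundle.{u, v', w} 𝕜 X) :
    QuasiBundle.{u, max v v', w} 𝕜 X where
  Fib := fun x => Q.Fib x × R.Fib x
  top := TopologicalSpace.induced
    (fun p => ((Q.pt p.1 p.2.1, R.pt p.1 p.2.2) : Q.Total × R.Total)) inferInstance
  continuous_fst :=
    continuous_comp_induced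
      (fun p : (Σ x, Q.Fib x × R.Fib x) => ((Q.pt p.1 p.2.1, R.pt p.1 p.2.2) : Q.Total × R.Total))
      (Q.continuous_proj.comp _root_.continuous_fst)

/-- The pullback `f^* Q`, with total space the fibre product of `Y` and the total space of `Q`. -/
abbrev pullback {Y : Type u'} [TopologicalSpace Y] (f : Y → X) (Q : QuasiBundle.{u, v, w} 𝕜 X) :
    QuasiBundle.{u, v, u'} 𝕜 Y where
  Fib := fun y => Q.Fib (f y)
  top := TopologicalSpace.induced
    (fun p => ((p.1, Q.pt (f p.1) p.2) : Y × Q.Total)) inferInstance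
  continuous_fst :=
    continuous_comp_induced
      (fun p : (Σ y, Q.Fib (f y)) => ((p.1, Q.pt (f p.1) p.2) : Y × Q.Total)) _root_.continuous_fst

/-- A finite-dimensional `𝕜`-vector bundle: every point has an open neighbourhood over which the
bundle is isomorphic to a product bundle `U × 𝕜ⁿ`; the rank `n` may depend on the point. -/
def IsVectorBundle (Q : QuasiBundle.{u, v, w} 𝕜 X) : Prop :=
  ∀ x₀ : X, ∃ U : Set X, IsOpen U ∧ x₀ ∈ U ∧ ∃ n : ℕ,
    Nonempty (Iso (Q.pullback (Subtype.val : U → X)) (trivial 𝕜 U (Fin n → 𝕜)))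

/-- The family of subspaces `S x ⊆ E x` of the fibres of a Banach bundle `E`, with the topology
induced from the total space of `E`. -/
abbrev ofSubmodule (𝕜 : Type u) [RCLike 𝕜] {X : Type w} [TopologicalSpace X]
    (F : Type u') [TopologicalSpace F] (E : X → Type v)
    [∀ x, AddCommMonoid (E x)] [∀ x, Module 𝕜 (E x)] [TopologicalSpace (TotalSpace F E)]
    [∀ x, TopologicalSpace (E x)] [FiberBundle F E] (S : ∀ x, Submodule 𝕜 (E x)) :
    QuasiBundle.{u, v, w} 𝕜 X where
  Fib := fun x => S x
  top := TopologicalSpace.induced (fun p => (⟨p.1, (p.2 : E p.1)⟩ : TotalSpace F E)) inferInstance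
  continuous_fst :=
    continuous_comp_induced
      (fun p : (Σ x, S x) => (⟨p.1, (p.2 : E p.1)⟩ : TotalSpace F E)) (FiberBundle.continuous_proj F E)

/-! Continuity of maps into the bundles above, and the resulting isomorphisms. -/

section Continuity

variable {Z : Type*} [TopologicalSpace Z]

theorem continuous_trivial_iff {W : Type v} [AddCommMonoid W] [Module 𝕜 W] [TopologicalSpace W]
    {g : Z → (trivial 𝕜 X W).Total} :
    Continuous g ↔ Continuous (fun z => (g z).1) ∧ Continuous (fun z => ((g z).2 : W)) :=
  continuous_induced_rng.trans continuous_prodMk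

theorem continuous_sum_iff {Q : QuasiBundle.{u, v, w} 𝕜 X} {R : QuasiBundle.{u, v', w} 𝕜 X}
    {g : Z → (Q.sum R).Total} :
    Continuous g ↔ Continuous (fun z => (Q.pt ((g z).1) ((g z).2.1))) ∧
      Continuous (fun z => (R.pt ((g z).1) ((g z).2.2))) :=
  continuous_induced_rng.trans continuous_prodMk

theorem continuous_pullback_iff {Y : Type u'} [TopologicalSpace Y] {f : Y → X}
    {Q : QuasiBundle.{u, v, w} 𝕜 X} {g : Z → (Q.pullback f).Total} :
    Continuous g ↔ Continuous (fun z => (g z).1) ∧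
      Continuous (fun z => (Q.pt (f (g z).1) ((g z).2))) :=
  continuous_induced_rng.trans continuous_prodMk

theorem continuous_sum_fst (Q : QuasiBundle.{u, v, w} 𝕜 X) (R : QuasiBundle.{u, v', w} 𝕜 X) :
    Continuous (fun p : (Q.sum R).Total => (Q.pt p.1 p.2.1)) :=
  (continuous_sum_iff.1 continuous_id).1

theorem continuous_sum_snd (Q : QuasiBundle.{u, v, w} 𝕜 X) (R : QuasiBundle.{u, v', w} 𝕜 X) :
    Continuous (fun p : (Q.sum R).Total => (R.pt p.1 p.2.2)) :=
  (continuous_sum_iff.1 continuous_id).2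

theorem continuous_pullback_lift {Y : Type u'} [TopologicalSpace Y] (f : Y → X)
    (Q : QuasiBundle.{u, v, w} 𝕜 X) :
    Continuous (fun p : (Q.pullback f).Total => (Q.pt (f p.1) p.2)) :=
  (continuous_pullback_iff.1 continuous_id).2

end Continuity

/-- Isomorphic model spaces give isomorphic product bundles. -/
def trivialCongr {W : Type v} [AddCommMonoid W] [Module 𝕜 W] [TopologicalSpace W]
    {W' : Type v'} [AddCommMonoid W'] [Module 𝕜 W'] [TopologicalSpace W'] (e : W ≃L[𝕜] W') :
    Iso (trivial 𝕜 X W) (trivial 𝕜 X W') where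
  equiv _ := e.toLinearEquiv
  continuous_equiv := continuous_trivial_iff.2 ⟨(trivial 𝕜 X W).continuous_proj,
    e.continuous.comp (continuous_trivial_iff.1 continuous_id).2⟩
  continuous_symm := continuous_trivial_iff.2 ⟨(trivial 𝕜 X W').continuous_proj,
    e.symm.continuous.comp (continuous_trivial_iff.1 continuous_id).2⟩

/-- `(X × W) ⊕ (X × W') ≅ X × (W × W')`. -/
def trivialSum (W : Type v) [AddCommMonoid W] [Module 𝕜 W] [TopologicalSpace W]
    (W' : Type v') [AddCommMonoid W'] [Module 𝕜 W'] [TopologicalSpace W'] :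
    Iso ((trivial 𝕜 X W).sum (trivial 𝕜 X W')) (trivial 𝕜 X (W × W')) where
  equiv _ := LinearEquiv.refl 𝕜 (W × W')
  continuous_equiv := continuous_trivial_iff.2 ⟨QuasiBundle.continuous_proj _,
    ((continuous_trivial_iff.1 (continuous_sum_fst _ _)).2).prodMk
      ((continuous_trivial_iff.1 (continuous_sum_snd _ _)).2)⟩
  continuous_symm := continuous_sum_iff.2
    ⟨continuous_trivial_iff.2 ⟨QuasiBundle.continuous_proj _,
      _root_.continuous_fst.comp (continuous_trivial_iff.1 continuous_id).2⟩,
    continuous_trivial_iff.2 ⟨QuasiBundle.continuous_proj _,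
      _root_.continuous_snd.comp (continuous_trivial_iff.1 continuous_id).2⟩⟩

/-- Direct sums of isomorphisms. -/
def Iso.sumCongr {Q : QuasiBundle.{u, v, w} 𝕜 X} {Q' : QuasiBundle.{u, v', w} 𝕜 X}
    {R : QuasiBundle.{u, w', w} 𝕜 X} {R' : QuasiBundle.{u, u', w} 𝕜 X} (e : Iso Q Q') (e' : Iso R R') : Iso (Q.sum R) (Q'.sum R') where
  equiv x := (e.equiv x).prodCongr (e'.equiv x)
  continuous_equiv := continuous_sum_iff.2
    ⟨e.continuous_equiv.comp (continuous_sum_fst _ _),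
      e'.continuous_equiv.comp (continuous_sum_snd _ _)⟩
  continuous_symm := continuous_sum_iff.2
    ⟨e.continuous_symm.comp (continuous_sum_fst _ _),
      e'.continuous_symm.comp (continuous_sum_snd _ _)⟩

/-- `Q ⊕ R ≅ R ⊕ Q`. -/
def sumComm (Q : QuasiBundle.{u, v, w} 𝕜 X) (R : QuasiBundle.{u, v', w} 𝕜 X) :
    Iso (Q.sum R) (R.sum Q) where
  equiv x := LinearEquiv.prodComm 𝕜 (Q.Fib x) (R.Fib x)
  continuous_equiv := continuous_sum_iff.2 ⟨continuous_sum_snd _ _, continuous_sum_fst _ _⟩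
  continuous_symm := continuous_sum_iff.2 ⟨continuous_sum_snd _ _, continuous_sum_fst _ _⟩

/-- `(Q ⊕ R) ⊕ S ≅ Q ⊕ (R ⊕ S)`. -/
def sumAssoc (Q R S : QuasiBundle.{u, v, w} 𝕜 X) :
    Iso ((Q.sum R).sum S) (Q.sum (R.sum S)) where
  equiv x := LinearEquiv.prodAssoc 𝕜 (Q.Fib x) (R.Fib x) (S.Fib x)
  continuous_equiv := continuous_sum_iff.2
    ⟨(continuous_sum_fst Q R).comp (continuous_sum_fst (Q.sum R) S), continuous_sum_iff.2
      ⟨(continuous_sum_snd Q R).comp (continuous_sum_fst (Q.sum R) S), continuous_sum_snd _ _⟩⟩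
  continuous_symm := continuous_sum_iff.2
    ⟨continuous_sum_iff.2 ⟨continuous_sum_fst _ _,
      (continuous_sum_fst _ _).comp (continuous_sum_snd _ _)⟩,
      (continuous_sum_snd R S).comp (continuous_sum_snd Q (R.sum S))⟩

/-- The zero bundle. -/
abbrev zero (𝕜 : Type u) [RCLike 𝕜] (X : Type w) [TopologicalSpace X] : QuasiBundle.{u, v, w} 𝕜 X :=
  trivial 𝕜 X PUnit.{v + 1}

/-- The zero bundle is a neutral element for `⊕`. -/
def zeroSum (Q : QuasiBundle.{u, v, w} 𝕜 X) : Iso ((zero.{u, v, w} 𝕜 X).sum Q) Q where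
  equiv _ :=
    { toFun := fun p => p.2
      invFun := fun q => (PUnit.unit, q)
      map_add' := fun _ _ => rfl
      map_smul' := fun _ _ => rfl
      left_inv := fun _ => rfl
      right_inv := fun _ => rfl }
  continuous_equiv := continuous_sum_snd _ _
  continuous_symm := continuous_sum_iff.2
    ⟨continuous_trivial_iff.2 ⟨Q.continuous_proj, continuous_const⟩, continuous_id⟩

section Pullback

variable {Y : Type u'} [TopologicalSpace Y] {f : Y → X}

/-- The pullback of an isomorphism. -/
def Iso.pullback {Q : QuasiBundle.{u, v, w} 𝕜 X} {R : QuasiBundle.{u, v', w} 𝕜 X} (e : Iso Q R)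
    (f : Y → X) : Iso (Q.pullback f) (R.pullback f) where
  equiv y := e.equiv (f y)
  continuous_equiv := continuous_pullback_iff.2
    ⟨QuasiBundle.continuous_proj _, e.continuous_equiv.comp (continuous_pullback_lift f Q)⟩
  continuous_symm := continuous_pullback_iff.2
    ⟨QuasiBundle.continuous_proj _, e.continuous_symm.comp (continuous_pullback_lift f R)⟩

/-- `f^* (Q ⊕ R) ≅ f^* Q ⊕ f^* R`. -/
def pullbackSum (f : Y → X) (Q : QuasiBundle.{u, v, w} 𝕜 X) (R : QuasiBundle.{u, v', w} 𝕜 X) :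
    Iso ((Q.sum R).pullback f) ((Q.pullback f).sum (R.pullback f)) where
  equiv y := LinearEquiv.refl 𝕜 (Q.Fib (f y) × R.Fib (f y))
  continuous_equiv := continuous_sum_iff.2
    ⟨continuous_pullback_iff.2 ⟨QuasiBundle.continuous_proj _,
      (continuous_sum_fst _ _).comp (continuous_pullback_lift f _)⟩,
    continuous_pullback_iff.2 ⟨QuasiBundle.continuous_proj _,
      (continuous_sum_snd _ _).comp (continuous_pullback_lift f _)⟩⟩
  continuous_symm := continuous_pullback_iff.2 ⟨QuasiBundle.continuous_proj _,
    continuous_sum_iff.2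
      ⟨(continuous_pullback_lift f _).comp (continuous_sum_fst _ _),
        (continuous_pullback_lift f _).comp (continuous_sum_snd _ _)⟩⟩

/-- The pullback of a product bundle under a continuous map is a product bundle. -/
def pullbackTrivial (hf : Continuous f) (W : Type v) [AddCommMonoid W] [Module 𝕜 W]
    [TopologicalSpace W] : Iso ((trivial 𝕜 X W).pullback f) (trivial 𝕜 Y W) where
  equiv _ := LinearEquiv.refl 𝕜 W
  continuous_equiv := continuous_trivial_iff.2 ⟨QuasiBundle.continuous_proj _,
    (continuous_trivial_iff.1 (continuous_pullback_lift f _)).2⟩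
  continuous_symm := continuous_pullback_iff.2 ⟨QuasiBundle.continuous_proj _,
    continuous_trivial_iff.2 ⟨hf.comp (QuasiBundle.continuous_proj _),
      (continuous_trivial_iff.1 continuous_id).2⟩⟩

/-- `g^* f^* Q ≅ (f ∘ g)^* Q`. -/
def pullbackPullback {Y' : Type*} [TopologicalSpace Y'] {g : Y' → Y} (hg : Continuous g)
    (f : Y → X) (Q : QuasiBundle.{u, v, w} 𝕜 X) :
    Iso ((Q.pullback f).pullback g) (Q.pullback (fun y => f (g y))) where
  equiv y := LinearEquiv.refl 𝕜 (Q.Fib (f (g y)))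
  continuous_equiv := continuous_pullback_iff.2 ⟨QuasiBundle.continuous_proj _,
    (continuous_pullback_lift f Q).comp (continuous_pullback_lift g _)⟩
  continuous_symm := continuous_pullback_iff.2 ⟨QuasiBundle.continuous_proj _,
    continuous_pullback_iff.2 ⟨hg.comp (QuasiBundle.continuous_proj _),
      continuous_pullback_lift _ Q⟩⟩

end Pullback

theorem isVectorBundle_trivial (W : Type v) [AddCommGroup W] [Module 𝕜 W] [TopologicalSpace W]
    [IsTopologicalAddGroup W] [ContinuousSMul 𝕜 W] [T2Space W] [FiniteDimensional 𝕜 W] :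
    (trivial 𝕜 X W).IsVectorBundle := by
  intro x₀
  refine ⟨Set.univ, isOpen_univ, Set.mem_univ _, Module.finrank 𝕜 W, ⟨?_⟩⟩
  refine (pullbackTrivial continuous_subtype_val W).trans (trivialCongr ?_)
  exact ContinuousLinearEquiv.ofFinrankEq (by simp)

theorem IsVectorBundle.pullback {Q : QuasiBundle.{u, v, w} 𝕜 X} (h : Q.IsVectorBundle)
    {Y : Type u'} [TopologicalSpace Y] {f : Y → X} (hf : Continuous f) :
    (Q.pullback f).IsVectorBundle := by
  intro y₀
  obtain ⟨U, hU, hx, n, ⟨e⟩⟩ := h (f y₀)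
  refine ⟨f ⁻¹' U, hU.preimage hf, hx, n, ⟨?_⟩⟩
  have hg : Continuous (fun y : f ⁻¹' U => (⟨f y, y.2⟩ : U)) := by fun_prop
  exact (pullbackPullback continuous_subtype_val f Q).trans
    (((pullbackPullback hg Subtype.val Q).symm.trans (e.pullback _)).trans
      (pullbackTrivial hg _))

theorem IsVectorBundle.sum {Q R : QuasiBundle.{u, v, w} 𝕜 X} (hQ : Q.IsVectorBundle)
    (hR : R.IsVectorBundle) : (Q.sum R).IsVectorBundle := by
  intro x₀
  obtain ⟨U, hU, hxU, n, ⟨e⟩⟩ := hQ x₀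
  obtain ⟨V, hV, hxV, m, ⟨e'⟩⟩ := hR x₀
  refine ⟨U ∩ V, hU.inter hV, ⟨hxU, hxV⟩, n + m, ⟨?_⟩⟩
  have hg : Continuous (fun y : (U ∩ V : Set X) => (⟨y, y.2.1⟩ : U)) := by fun_prop
  have hg' : Continuous (fun y : (U ∩ V : Set X) => (⟨y, y.2.2⟩ : V)) := by fun_prop
  have a := ((pullbackPullback hg Subtype.val Q).symm.trans (e.pullback _)).trans
    (pullbackTrivial hg (Fin n → 𝕜))
  have b := ((pullbackPullback hg' Subtype.val R).symm.trans (e'.pullback _)).trans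
    (pullbackTrivial hg' (Fin m → 𝕜))
  refine (pullbackSum _ Q R).trans (((Iso.sumCongr a b).trans (trivialSum _ _)).trans
    (trivialCongr ?_))
  exact ContinuousLinearEquiv.ofFinrankEq (by simp)

end Basic

end QuasiBundle

/-- A finite-dimensional vector bundle over `X` (with locally constant rank). -/
structure VectBundle (𝕜 : Type u) [RCLike 𝕜] (X : Type w) [TopologicalSpace X] where
  toQuasiBundle : QuasiBundle.{u, v, w} 𝕜 X
  isVectorBundle : toQuasiBundle.IsVectorBundle

/-- The isomorphism relation on vector bundles. -/
instance VectBundle.setoid (𝕜 : Type u) [RCLike 𝕜] (X : Type w) [TopologicalSpace X] :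
    Setoid (VectBundle.{u, v, w} 𝕜 X) where
  r A B := Nonempty (QuasiBundle.Iso A.toQuasiBundle B.toQuasiBundle)
  iseqv :=
    { refl := fun _ => ⟨QuasiBundle.Iso.refl _⟩
      symm := fun ⟨e⟩ => ⟨e.symm⟩
      trans := fun ⟨e⟩ ⟨e'⟩ => ⟨e.trans e'⟩ }

/-- The set `Vect(X)` of isomorphism classes of finite-dimensional vector bundles over `X`. -/
def VectClass (𝕜 : Type u) [RCLike 𝕜] (X : Type w) [TopologicalSpace X] :=
  Quotient (VectBundle.setoid.{u, v, w} 𝕜 X)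

namespace VectClass

variable {𝕜 : Type u} [RCLike 𝕜] {X : Type w} [TopologicalSpace X]

/-- The isomorphism class of a vector bundle. -/
def mk (Q : QuasiBundle.{u, v, w} 𝕜 X) (h : Q.IsVectorBundle) : VectClass.{u, v, w} 𝕜 X :=
  Quotient.mk _ ⟨Q, h⟩

/-- The sum `[A] + [B] = [A ⊕ B]`. -/
instance : Add (VectClass.{u, v, w} 𝕜 X) where
  add := Quotient.map₂
    (fun A B => ⟨A.toQuasiBundle.sum B.toQuasiBundle, A.isVectorBundle.sum B.isVectorBundle⟩)
    (fun _ _ ⟨e⟩ _ _ ⟨e'⟩ => ⟨e.sumCongr e'⟩)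

/-- The class of the zero bundle. -/
instance : Zero (VectClass.{u, v, w} 𝕜 X) where
  zero := mk (QuasiBundle.zero 𝕜 X) (QuasiBundle.isVectorBundle_trivial _)

/-- `Vect(X)` is a commutative monoid under the direct sum. -/
instance : AddCommMonoid (VectClass.{u, v, w} 𝕜 X) where
  add_assoc := by
    rintro ⟨A⟩ ⟨B⟩ ⟨C⟩
    exact Quotient.sound ⟨QuasiBundle.sumAssoc _ _ _⟩
  add_comm := by
    rintro ⟨A⟩ ⟨B⟩
    exact Quotient.sound ⟨QuasiBundle.sumComm _ _⟩
  zero_add := by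
    rintro ⟨A⟩
    exact Quotient.sound ⟨QuasiBundle.zeroSum _⟩
  add_zero := by
    rintro ⟨A⟩
    exact Quotient.sound ⟨(QuasiBundle.sumComm _ _).trans (QuasiBundle.zeroSum _)⟩
  nsmul := nsmulRec

/-- The pullback `f^* : Vect(X) → Vect(Y)`, `[A] ↦ [f^* A]`. -/
def pullback {Y : Type u'} [TopologicalSpace Y] (f : C(Y, X)) :
    VectClass.{u, v, w} 𝕜 X →+ VectClass.{u, v, u'} 𝕜 Y where
  toFun := Quotient.map
    (fun A => ⟨A.toQuasiBundle.pullback f, A.isVectorBundle.pullback f.continuous⟩)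
    (fun _ _ ⟨e⟩ => ⟨e.pullback f⟩)
  map_zero' := Quotient.sound ⟨QuasiBundle.pullbackTrivial f.continuous _⟩
  map_add' := by
    rintro ⟨A⟩ ⟨B⟩
    exact Quotient.sound ⟨QuasiBundle.pullbackSum f _ _⟩

end VectClass

/-- Topological K-theory: the Grothendieck group of `Vect(X)` (so `K(X)` for `𝕜 = ℂ` and `KO(X)` for
`𝕜 = ℝ`). -/
abbrev KGroup (𝕜 : Type u) [RCLike 𝕜] (X : Type w) [TopologicalSpace X] :=
  Algebra.GrothendieckAddGroup (VectClass.{u, v, w} 𝕜 X)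

/-- The class `[Q] ∈ K(X)` of a vector bundle `Q`. -/
noncomputable def KGroup.mk {𝕜 : Type u} [RCLike 𝕜] {X : Type w} [TopologicalSpace X]
    (Q : QuasiBundle.{u, v, w} 𝕜 X) (h : Q.IsVectorBundle) : KGroup.{u, v, w} 𝕜 X :=
  Algebra.GrothendieckAddGroup.of (VectClass.mk Q h)

/-- The pullback homomorphism `f^* : K(X) → K(Y)`. -/
noncomputable def KGroup.pullback {𝕜 : Type u} [RCLike 𝕜] {X : Type w} [TopologicalSpace X]
    {Y : Type u'} [TopologicalSpace Y] (f : C(Y, X)) :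
    KGroup.{u, v, w} 𝕜 X →+ KGroup.{u, v, u'} 𝕜 Y :=
  Algebra.GrothendieckAddGroup.lift
    (Algebra.GrothendieckAddGroup.of.comp (VectClass.pullback f))

section Fredholm

variable {𝕜 : Type u} [RCLike 𝕜] {X : Type w} [TopologicalSpace X]
  (F₁ : Type*) [NormedAddCommGroup F₁] [NormedSpace 𝕜 F₁]
  (F₂ : Type*) [NormedAddCommGroup F₂] [NormedSpace 𝕜 F₂]

/-- A Fredholm morphism between Banach bundles: a family of bounded operators between the fibres
that is norm-continuous in local trivialisations (that is, a continuous section of the bundle of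
bounded operators) and is Fredholm in each fibre. -/
def IsFredholmMorphism {E₁ : X → Type v} {E₂ : X → Type v}
    [∀ x, AddCommGroup (E₁ x)] [∀ x, Module 𝕜 (E₁ x)] [TopologicalSpace (TotalSpace F₁ E₁)]
    [∀ x, TopologicalSpace (E₁ x)] [FiberBundle F₁ E₁] [VectorBundle 𝕜 F₁ E₁]
    [∀ x, AddCommGroup (E₂ x)] [∀ x, Module 𝕜 (E₂ x)] [TopologicalSpace (TotalSpace F₂ E₂)]
    [∀ x, TopologicalSpace (E₂ x)] [FiberBundle F₂ E₂] [VectorBundle 𝕜 F₂ E₂]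
    [∀ x, IsTopologicalAddGroup (E₂ x)] [∀ x, ContinuousSMul 𝕜 (E₂ x)]
    (L : ∀ x, E₁ x →L[𝕜] E₂ x) : Prop :=
  Continuous (fun x => TotalSpace.mk' (F₁ →L[𝕜] F₂) (E := fun x => E₁ x →L[𝕜] E₂ x) x (L x)) ∧
    ∀ x, (L x).IsFredholm

variable {E₁ : X → Type v} {E₂ : X → Type v}
  [∀ x, AddCommMonoid (E₁ x)] [∀ x, Module 𝕜 (E₁ x)] [TopologicalSpace (TotalSpace F₁ E₁)]
  [∀ x, TopologicalSpace (E₁ x)] [FiberBundle F₁ E₁]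
  [∀ x, AddCommMonoid (E₂ x)] [∀ x, Module 𝕜 (E₂ x)] [TopologicalSpace (TotalSpace F₂ E₂)]
  [∀ x, TopologicalSpace (E₂ x)] [FiberBundle F₂ E₂]

/-- `κ` is of the form `[E(L, V)] - [V]` for some finite-dimensional subbundle `V` of `E₂` that is
transversal to the image of `L`, that is, `im L x + V x = E₂ x` for all `x`.  Here `E(L, V)` is the
subbundle of `E₁` with fibres `{u | L x u ∈ V x}`. -/
def IsIndexClass (L : ∀ x, E₁ x →L[𝕜] E₂ x) (κ : KGroup.{u, v, w} 𝕜 X) : Prop :=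
  ∃ (V : ∀ x, Submodule 𝕜 (E₂ x))
    (hV : (QuasiBundle.ofSubmodule 𝕜 F₂ E₂ V).IsVectorBundle)
    (hE : (QuasiBundle.ofSubmodule 𝕜 F₁ E₁
      (fun x => (V x).comap (L x : E₁ x →ₗ[𝕜] E₂ x))).IsVectorBundle),
    (∀ x, LinearMap.range (L x : E₁ x →ₗ[𝕜] E₂ x) ⊔ V x = ⊤) ∧
      κ = KGroup.mk _ hE - KGroup.mk _ hV

open Classical in
/-- The index bundle `ind L ∈ K(X)`: the element `[E(L, V)] - [V]` for a transversal
finite-dimensional subbundle `V` (and `0` if there is no such element). -/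
noncomputable def indexBundle (L : ∀ x, E₁ x →L[𝕜] E₂ x) : KGroup.{u, v, w} 𝕜 X :=
  if h : ∃ κ, IsIndexClass F₁ F₂ L κ then h.choose else 0

/-- The pullback `f^* L : f^* E₁ → f^* E₂` of a morphism, `(f^* L) y = L (f y)`. -/
def pullbackMorphism {Y : Type u'} [TopologicalSpace Y] (f : C(Y, X))
    (L : ∀ x, E₁ x →L[𝕜] E₂ x) :
    ∀ y, ((f : Y → X) *ᵖ E₁) y →L[𝕜] ((f : Y → X) *ᵖ E₂) y :=
  fun y => L (f y)

end Fredholm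

/-! In charts `L` is a norm-continuous family `T` of operators between Banach spaces, and `V` is
parametrised by `𝕜ⁿ` through maps `Φ`. Transversality at a point says that `(u, a) ↦ T u + Φ a` is
surjective there. Its kernel is finite-dimensional, so adjoining a suitable operator `C` of finite
rank makes it invertible. Invertibility persists nearby, with a continuous inverse `R`
(`exists_local_solution`). Restricted to `0 × 𝕜ᵐ`, `R` trivialises `E(L, V)`
(`isVectorBundle_comap`). Restricted to `F₂ × 0`, it gives local maps `τ` with `L (τ b) + b ∈ V`;
this condition is affine in `τ`, so a partition of unity glues them (`exists_parametrix`).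

Independence of `V`: by means of such maps for `V` and `V'`, both `E(L, V) ⊕ V'` and `E(L, V') ⊕ V`
are identified with the triples `(w, v, v')` satisfying `L w + v + v' = 0`. Hence they are
isomorphic (`nonempty_iso_exchange`), and no relation between `V` and `V'` is needed.

Existence of `V`: finitely many sections, constant in charts and glued by a partition of unity, span
a complement of the image everywhere, but they may be linearly dependent at some points. If the
fibre is finite-dimensional, the whole target serves. Otherwise the constants are perturbed: the
forbidden values of each constant form a countable union of compact sets, which has empty interior
by Baire's theorem (`exists_gluedFrame_injective`). Transversality is open, uniformly over the
compact base, so it survives a small perturbation (`exists_transversal`).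

Naturality holds because a transversal subbundle pulls back to a transversal one, and uniqueness
over `Y` identifies the classes. Homotopy invariance follows from that of vector bundles: over a
compact Hausdorff base a bundle is the image of a continuous family of projections, and nearby
projections have isomorphic images (`nonempty_iso_of_homotopic`). -/

namespace QuasiBundle

/-! ### Local trivialisations of quasi-vector bundles -/

section Charts

variable {𝕜 : Type u} [RCLike 𝕜] {X : Type w} [TopologicalSpace X]

/-- The family of subspaces `S x` of the fibres of a quasi-vector bundle, with the topology induced
from the total space. -/
abbrev sub (Q : QuasiBundle.{u, v, w} 𝕜 X) (S : ∀ x, Submodule 𝕜 (Q.Fib x)) :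
    QuasiBundle.{u, v, w} 𝕜 X where
  Fib := fun x => S x
  top := TopologicalSpace.induced (fun p => Q.pt p.1 (p.2 : Q.Fib p.1)) inferInstance
  continuous_fst :=
    continuous_comp_induced
      (fun p : (Σ x, S x) => Q.pt p.1 (p.2 : Q.Fib p.1)) Q.continuous_proj

theorem continuousAt_sub_iff {Z : Type*} [TopologicalSpace Z] {Q : QuasiBundle.{u, v, w} 𝕜 X}
    {S : ∀ x, Submodule 𝕜 (Q.Fib x)} {g : Z → (Q.sub S).Total} {z : Z} :
    ContinuousAt g z ↔ ContinuousAt (fun z => Q.pt (g z).1 ((g z).2 : Q.Fib (g z).1)) z :=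
  (Topology.IsInducing.mk rfl :
    Topology.IsInducing (fun p : (Q.sub S).Total => Q.pt p.1 (p.2 : Q.Fib p.1))).continuousAt_iff

theorem continuous_sub_val {Q : QuasiBundle.{u, v, w} 𝕜 X} (S : ∀ x, Submodule 𝕜 (Q.Fib x)) :
    Continuous (fun p : (Q.sub S).Total => Q.pt p.1 (p.2 : Q.Fib p.1)) :=
  continuous_iff_continuousAt.2 fun _ => continuousAt_sub_iff.1 continuousAt_id

/-- A local trivialisation of a quasi-vector bundle over an open set `source`, given by linear maps
that are defined on all fibres and mutually inverse over `source`. -/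
structure Chart (Q : QuasiBundle.{u, v, w} 𝕜 X) (W : Type*) [AddCommGroup W] [Module 𝕜 W]
    [TopologicalSpace W] where
  source : Set X
  isOpen_source : IsOpen source
  coord : ∀ x, Q.Fib x →ₗ[𝕜] W
  inv : ∀ x, W →ₗ[𝕜] Q.Fib x
  inv_coord : ∀ x ∈ source, ∀ a, inv x (coord x a) = a
  coord_inv : ∀ x ∈ source, ∀ a, coord x (inv x a) = a
  continuousOn_coord : ContinuousOn (fun p : Q.Total => coord p.1 p.2) (proj ⁻¹' source)
  continuousOn_inv : ContinuousOn (fun q : X × W => Q.pt q.1 (inv q.1 q.2)) (source ×ˢ Set.univ)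

namespace Chart

variable {Q : QuasiBundle.{u, v, w} 𝕜 X} {W : Type*} [AddCommGroup W] [Module 𝕜 W]
  [TopologicalSpace W]

/-- Continuity into the total space is thereby tested in the model space. Only `h z₀` has to lie
over the chart, since continuity of `h` keeps nearby points there. -/
theorem continuousAt_iff (c : Chart Q W) {Z : Type*} [TopologicalSpace Z] {h : Z → X}
    {a : ∀ z, Q.Fib (h z)} {z₀ : Z} (hz : h z₀ ∈ c.source) :
    ContinuousAt (fun z => Q.pt (h z) (a z)) z₀ ↔
      ContinuousAt h z₀ ∧ ContinuousAt (fun z => c.coord (h z) (a z)) z₀ := by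
  constructor
  · intro H
    have hh : ContinuousAt h z₀ :=
      ContinuousAt.comp (f := fun z => Q.pt (h z) (a z)) Q.continuous_proj.continuousAt H
    have h1 : ContinuousAt (fun p : Q.Total => c.coord p.1 p.2) (Q.pt (h z₀) (a z₀)) :=
      c.continuousOn_coord.continuousAt
        ((c.isOpen_source.preimage Q.continuous_proj).mem_nhds hz)
    exact ⟨hh, ContinuousAt.comp (f := fun z => Q.pt (h z) (a z)) h1 H⟩
  · rintro ⟨h1, h2⟩
    have h3 : ContinuousAt (fun q : X × W => Q.pt q.1 (c.inv q.1 q.2))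
        (h z₀, c.coord (h z₀) (a z₀)) :=
      c.continuousOn_inv.continuousAt
        ((c.isOpen_source.prod isOpen_univ).mem_nhds ⟨hz, Set.mem_univ _⟩)
    have h4 : ContinuousAt (fun z => Q.pt (h z) (c.inv (h z) (c.coord (h z) (a z)))) z₀ :=
      ContinuousAt.comp (f := fun z => (h z, c.coord (h z) (a z))) h3 (h1.prodMk h2)
    refine h4.congr ?_
    filter_upwards [h1 (c.isOpen_source.mem_nhds hz)] with z hz
    rw [c.inv_coord _ hz]

theorem continuousAt_coord (c : Chart Q W) {Z : Type*} [TopologicalSpace Z] {h : Z → X}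
    {a : ∀ z, Q.Fib (h z)} {z₀ : Z} (hz : h z₀ ∈ c.source)
    (H : ContinuousAt (fun z => Q.pt (h z) (a z)) z₀) :
    ContinuousAt (fun z => c.coord (h z) (a z)) z₀ :=
  ((c.continuousAt_iff hz).1 H).2

theorem continuousAt_inv (c : Chart Q W) {Z : Type*} [TopologicalSpace Z] {h : Z → X}
    {a : Z → W} {z₀ : Z} (hz : h z₀ ∈ c.source) (hh : ContinuousAt h z₀)
    (ha : ContinuousAt a z₀) :
    ContinuousAt (fun z => Q.pt (h z) (c.inv (h z) (a z))) z₀ := by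
  refine (c.continuousAt_iff hz).2 ⟨hh, ha.congr ?_⟩
  filter_upwards [hh (c.isOpen_source.mem_nhds hz)] with z hz
  rw [c.coord_inv _ hz]

theorem coord_injective (c : Chart Q W) {x : X} (hx : x ∈ c.source) :
    Function.Injective (c.coord x) :=
  Function.LeftInverse.injective (g := c.inv x) (c.inv_coord x hx)

/-- Composition of a chart with a continuous linear equivalence of the model space. -/
def congr (c : Chart Q W) {W' : Type*} [AddCommGroup W'] [Module 𝕜 W'] [TopologicalSpace W']
    (e : W ≃L[𝕜] W') : Chart Q W' where
  source := c.source
  isOpen_source := c.isOpen_source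
  coord x := (e : W →ₗ[𝕜] W') ∘ₗ c.coord x
  inv x := c.inv x ∘ₗ (e.symm : W' →ₗ[𝕜] W)
  inv_coord x hx a := by simp [c.inv_coord x hx]
  coord_inv x hx a := by simp [c.coord_inv x hx]
  continuousOn_coord := e.continuous.comp_continuousOn c.continuousOn_coord
  continuousOn_inv := c.continuousOn_inv.comp (f := fun q : X × W' => (q.1, e.symm q.2))
    (by fun_prop) (fun q hq => ⟨hq.1, Set.mem_univ _⟩)

/-- A chart that is given by an isomorphism with a product bundle over an open set. -/
theorem exists_of_iso {U : Set X} (hU : IsOpen U)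
    (e : Iso (Q.pullback (Subtype.val : U → X)) (trivial 𝕜 U W)) :
    ∃ c : Chart Q W, c.source = U := by
  classical
  refine ⟨{
    source := U
    isOpen_source := hU
    -- Off `U` the maps are set to zero; no chart axiom refers to those fibres.
    coord := fun x => if h : x ∈ U then (e.equiv ⟨x, h⟩ : Q.Fib x →ₗ[𝕜] W) else 0
    inv := fun x => if h : x ∈ U then ((e.equiv ⟨x, h⟩).symm : W →ₗ[𝕜] Q.Fib x) else 0
    inv_coord := ?_
    coord_inv := ?_
    continuousOn_coord := ?_
    continuousOn_inv := ?_ }, rfl⟩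
  · intro x hx a
    simp only [dif_pos hx]
    exact (e.equiv ⟨x, hx⟩).symm_apply_apply a
  · intro x hx a
    simp only [dif_pos hx]
    exact (e.equiv ⟨x, hx⟩).apply_symm_apply a
  · rw [continuousOn_iff_continuous_domRestrict]
    have h1 : Continuous (fun p : (proj ⁻¹' U : Set Q.Total) =>
        (Q.pullback (Subtype.val : U → X)).pt ⟨p.1.1, p.2⟩ p.1.2) :=
      continuous_pullback_iff.2 ⟨(Q.continuous_proj.comp continuous_subtype_val).subtype_mk _,
        continuous_subtype_val⟩
    refine ((continuous_trivial_iff.1 (e.continuous_equiv.comp h1)).2).congr ?_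
    rintro ⟨p, hp⟩
    have hp : p.1 ∈ U := hp
    simp only [Set.domRestrict_apply, dif_pos hp]
    rfl
  · rw [continuousOn_iff_continuous_domRestrict]
    have h1 : Continuous (fun q : (U ×ˢ Set.univ : Set (X × W)) =>
        (trivial 𝕜 U W).pt ⟨q.1.1, q.2.1⟩ q.1.2) :=
      continuous_trivial_iff.2 ⟨(_root_.continuous_fst.comp continuous_subtype_val).subtype_mk _,
        _root_.continuous_snd.comp continuous_subtype_val⟩
    refine ((continuous_pullback_iff.1 (e.continuous_symm.comp h1)).2).congr ?_
    rintro ⟨q, hq⟩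
    simp only [Set.domRestrict_apply, dif_pos hq.1]
    rfl

/-- The isomorphism with a product bundle that is given by a chart. -/
def toIso (c : Chart Q W) :
    Iso (Q.pullback (Subtype.val : c.source → X)) (trivial 𝕜 c.source W) where
  equiv x := LinearEquiv.ofLinearMap (c.coord x) (c.inv x)
    (LinearMap.ext (c.coord_inv x x.2)) (LinearMap.ext (c.inv_coord x x.2))
  continuous_equiv := continuous_trivial_iff.2 ⟨QuasiBundle.continuous_proj _,
    continuous_iff_continuousAt.2 fun p => c.continuousAt_coord
      (h := fun p : (Q.pullback (Subtype.val : c.source → X)).Total => (p.1 : X))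
      (a := fun p => p.2) p.1.2 (continuous_pullback_lift _ Q).continuousAt⟩
  continuous_symm := continuous_pullback_iff.2 ⟨QuasiBundle.continuous_proj _,
    continuous_iff_continuousAt.2 fun p => c.continuousAt_inv
      (h := fun p : (trivial 𝕜 c.source W).Total => (p.1 : X)) (a := fun p => p.2) p.1.2
      (continuous_subtype_val.comp (QuasiBundle.continuous_proj _)).continuousAt
      (continuous_trivial_iff.1 continuous_id).2.continuousAt⟩

end Chart

theorem IsVectorBundle.exists_chart {Q : QuasiBundle.{u, v, w} 𝕜 X} (h : Q.IsVectorBundle)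
    (x : X) : ∃ (n : ℕ) (c : Chart Q (Fin n → 𝕜)), x ∈ c.source := by
  obtain ⟨U, hU, hx, n, ⟨e⟩⟩ := h x
  obtain ⟨c, hc⟩ := Chart.exists_of_iso hU e
  exact ⟨n, c, hc ▸ hx⟩

theorem IsVectorBundle.of_charts {Q : QuasiBundle.{u, v, w} 𝕜 X}
    (h : ∀ x, ∃ (n : ℕ) (c : Chart Q (Fin n → 𝕜)), x ∈ c.source) : Q.IsVectorBundle := by
  intro x
  obtain ⟨n, c, hc⟩ := h x
  exact ⟨c.source, c.isOpen_source, hc, n, ⟨c.toIso⟩⟩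

theorem IsVectorBundle.of_iso {Q : QuasiBundle.{u, v, w} 𝕜 X} {R : QuasiBundle.{u, v', w} 𝕜 X}
    (e : Iso Q R) (h : R.IsVectorBundle) : Q.IsVectorBundle := by
  intro x
  obtain ⟨U, hU, hx, n, ⟨e'⟩⟩ := h x
  exact ⟨U, hU, hx, n, ⟨(e.pullback _).trans e'⟩⟩

/-- The pullback of a chart. -/
theorem Chart.exists_pullback {Q : QuasiBundle.{u, v, w} 𝕜 X} {W : Type*} [AddCommGroup W]
    [Module 𝕜 W] [TopologicalSpace W] (c : Chart Q W) {Y : Type u'} [TopologicalSpace Y]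
    {f : Y → X} (hf : Continuous f) :
    ∃ c' : Chart (Q.pullback f) W, c'.source = f ⁻¹' c.source ∧
      (∀ y, c'.coord y = c.coord (f y)) ∧ ∀ y, c'.inv y = c.inv (f y) := by
  refine ⟨{
    source := f ⁻¹' c.source
    isOpen_source := c.isOpen_source.preimage hf
    coord := fun y => c.coord (f y)
    inv := fun y => c.inv (f y)
    inv_coord := fun y hy => c.inv_coord _ hy
    coord_inv := fun y hy => c.coord_inv _ hy
    continuousOn_coord := fun p hp => ContinuousAt.continuousWithinAt
      (c.continuousAt_coord (h := fun p : (Q.pullback f).Total => f p.1) (a := fun p => p.2) hp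
        (continuous_pullback_lift f Q).continuousAt)
    continuousOn_inv := ?_ }, rfl, fun _ => rfl, fun _ => rfl⟩
  have : ContinuousOn (fun q : Y × W => Q.pt (f q.1) (c.inv (f q.1) q.2))
      ((f ⁻¹' c.source) ×ˢ Set.univ) := fun q hq => ContinuousAt.continuousWithinAt
    (c.continuousAt_inv (h := fun q : Y × W => f q.1) hq.1 (by fun_prop) (by fun_prop))
  rw [continuousOn_iff_continuous_domRestrict] at this ⊢
  exact continuous_pullback_iff.2 ⟨_root_.continuous_fst.comp continuous_subtype_val, this⟩

end Charts

end QuasiBundle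

/-! ### Inverting continuous families of operators, and partitions of unity -/

section Inverse

variable {𝕜 : Type*} [RCLike 𝕜] {G F : Type*} [NormedAddCommGroup G] [NormedSpace 𝕜 G]
  [NormedAddCommGroup F] [NormedSpace 𝕜 F] {Z : Type*} [TopologicalSpace Z]

theorem ContinuousLinearMap.continuousAt_coprod {H : Type*} [NormedAddCommGroup H]
    [NormedSpace 𝕜 H] {A : Z → G →L[𝕜] F} {B : Z → H →L[𝕜] F} {z₀ : Z}
    (hA : ContinuousAt A z₀) (hB : ContinuousAt B z₀) :
    ContinuousAt (fun z => (A z).coprod (B z)) z₀ := by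
  have h : ∀ z, (A z).coprod (B z) = (A z) ∘L (ContinuousLinearMap.fst 𝕜 G H) +
    (B z) ∘L (ContinuousLinearMap.snd 𝕜 G H) := fun z => by ext <;> simp
  simp only [h]
  exact (hA.clm_comp continuousAt_const).add (hB.clm_comp continuousAt_const)

theorem ContinuousLinearMap.continuousAt_prod {H : Type*} [NormedAddCommGroup H]
    [NormedSpace 𝕜 H] {A : Z → G →L[𝕜] F} {B : Z → G →L[𝕜] H} {z₀ : Z}
    (hA : ContinuousAt A z₀) (hB : ContinuousAt B z₀) :
    ContinuousAt (fun z => (A z).prod (B z)) z₀ := by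
  have h : ∀ z, (A z).prod (B z) = (ContinuousLinearMap.inl 𝕜 F H) ∘L (A z) +
    (ContinuousLinearMap.inr 𝕜 F H) ∘L (B z) := fun z => by ext <;> simp
  simp only [h]
  exact (continuousAt_const.clm_comp hA).add (continuousAt_const.clm_comp hB)

/-- A norm-continuous family of bounded operators that is invertible at a point has a
norm-continuous family of inverses near that point. -/
theorem ContinuousLinearMap.exists_inverse_near [CompleteSpace G] {A : Z → G →L[𝕜] F} {z₀ : Z}
    (hA : ∀ᶠ z in 𝓝 z₀, ContinuousAt A z) (e : G ≃L[𝕜] F) (he : (e : G →L[𝕜] F) = A z₀) :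
    ∃ B : Z → F →L[𝕜] G, ∀ᶠ z in 𝓝 z₀, ContinuousAt B z ∧ (∀ g, B z (A z g) = g) ∧
      ∀ f, A z (B z f) = f := by
  refine ⟨fun z => (A z).inverse, ?_⟩
  have h1 : ∀ᶠ z in 𝓝 z₀, A z ∈ Set.range ((↑) : (G ≃L[𝕜] F) → G →L[𝕜] F) :=
    hA.self_of_nhds (he ▸ e.nhds)
  filter_upwards [hA, h1] with z hz h1
  obtain ⟨e', he'⟩ := h1
  refine ⟨?_, fun g => ?_, fun f => ?_⟩
  · have h2 : ContinuousAt (ContinuousLinearMap.inverse : (G →L[𝕜] F) → F →L[𝕜] G) (A z) := by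
      rw [← he']
      exact (contDiffAt_map_inverse (n := 0) e').continuousAt
    exact ContinuousAt.comp h2 hz
  · rw [← he', ContinuousLinearMap.inverse_equiv]; simp
  · rw [← he', ContinuousLinearMap.inverse_equiv]; simp

/-- Near a point where it is surjective with finite-dimensional kernel, a norm-continuous family of
bounded operators `A` can be complemented by a constant operator `C` of finite rank to a family of
invertible operators `(A, C)` with norm-continuous inverse. -/
theorem ContinuousLinearMap.exists_inverse_prod_near [CompleteSpace G] [CompleteSpace F]
    {A : Z → G →L[𝕜] F} {z₀ : Z} (hA : ∀ᶠ z in 𝓝 z₀, ContinuousAt A z)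
    (hs : Function.Surjective (A z₀)) (hk : Module.Finite 𝕜 (A z₀).ker) :
    ∃ (d : ℕ) (C : G →L[𝕜] (Fin d → 𝕜)) (B : Z → (F × (Fin d → 𝕜)) →L[𝕜] G),
      ∀ᶠ z in 𝓝 z₀, ContinuousAt B z ∧ (∀ g, B z (A z g, C g) = g) ∧
        ∀ f k, A z (B z (f, k)) = f ∧ C (B z (f, k)) = k := by
  obtain ⟨p, hp⟩ := Submodule.ClosedComplemented.of_finiteDimensional (A z₀).ker
  let e : (A z₀).ker ≃L[𝕜] (Fin (Module.finrank 𝕜 (A z₀).ker) → 𝕜) :=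
    ContinuousLinearEquiv.ofFinrankEq (by simp)
  -- `C` is a continuous projection onto the kernel at `z₀`, read in coordinates: it is bijective on
  -- the kernel, so `(A z₀, C)` is bijective.
  let C : G →L[𝕜] (Fin (Module.finrank 𝕜 (A z₀).ker) → 𝕜) := (e : _ →L[𝕜] _) ∘L p
  have hinj : Function.Injective ((A z₀).prod C) := by
    rw [injective_iff_map_eq_zero]
    intro g hg
    obtain ⟨h1, h2⟩ := Prod.mk_inj.1 (show ((A z₀) g, C g) = (0, 0) from hg)
    have h3 := hp ⟨g, h1⟩
    have h4 : p g = 0 := e.injective (by simpa [C] using h2)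
    rw [h4] at h3
    exact (congrArg Subtype.val h3).symm
  have hsurj : Function.Surjective ((A z₀).prod C) := by
    rintro ⟨f, k⟩
    obtain ⟨g, rfl⟩ := hs f
    -- Changing `g` by a kernel element leaves its image under `A z₀` fixed and adjusts its kernel
    -- component to `k`.
    refine ⟨g + ((e.symm k - p g : (A z₀).ker) : G), Prod.ext ?_ ?_⟩
    · have : A z₀ ((e.symm k - p g : (A z₀).ker) : G) = 0 := (e.symm k - p g : (A z₀).ker).2
      simp only [ContinuousLinearMap.prod_apply, map_add, this, Prod.mk_add_mk, add_zero]
    · simp [C, hp]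
  obtain ⟨B, hB⟩ := ContinuousLinearMap.exists_inverse_near (A := fun z => (A z).prod C) (z₀ := z₀)
    (by
      filter_upwards [hA] with z hz
      exact ContinuousLinearMap.continuousAt_prod hz continuousAt_const)
    (ContinuousLinearEquiv.ofBijective ((A z₀).prod C) (LinearMap.ker_eq_bot.2 hinj)
      (LinearMap.range_eq_top.2 hsurj)) (by ext <;> rfl)
  refine ⟨_, C, B, hB.mono fun z ⟨h1, h2, h3⟩ => ⟨h1, h2, fun f k => ?_⟩⟩
  exact Prod.mk_inj.1 (h3 (f, k))

end Inverse

theorem LinearMap.finite_of_finite_ker {𝕜 M N : Type*} [Field 𝕜] [AddCommGroup M] [Module 𝕜 M]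
    [AddCommGroup N] [Module 𝕜 N] [Module.Finite 𝕜 N] (f : M →ₗ[𝕜] N)
    [Module.Finite 𝕜 (LinearMap.ker f)] : Module.Finite 𝕜 M :=
  have : Module.Finite 𝕜 (M ⧸ LinearMap.ker f) := .equiv f.quotKerEquivRange.symm
  .of_submodule_quotient (LinearMap.ker f)

/-- Project this kernel to `H`: the target is finite-dimensional, and the kernel of the projection
consists of the pairs `(g, 0)` with `T g = 0`. -/
theorem ContinuousLinearMap.finite_ker_coprod {𝕜 G H F : Type*} [RCLike 𝕜]
    [NormedAddCommGroup G] [NormedSpace 𝕜 G] [NormedAddCommGroup F] [NormedSpace 𝕜 F]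
    [NormedAddCommGroup H] [NormedSpace 𝕜 H] [Module.Finite 𝕜 H] (T : G →L[𝕜] F) (Φ : H →L[𝕜] F)
    (hT : Module.Finite 𝕜 T.ker) : Module.Finite 𝕜 (T.coprod Φ).ker := by
  let f : (T.coprod Φ).ker →ₗ[𝕜] H := LinearMap.snd 𝕜 G H ∘ₗ (T.coprod Φ).ker.subtype
  have h0 : ∀ p : LinearMap.ker f, p.1.1.2 = 0 := fun p => p.2
  have : Module.Finite 𝕜 (LinearMap.ker f) := by
    let g : LinearMap.ker f →ₗ[𝕜] T.ker := LinearMap.codRestrict _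
      (LinearMap.fst 𝕜 G H ∘ₗ (T.coprod Φ).ker.subtype ∘ₗ (LinearMap.ker f).subtype) (fun p => by
        have h1 : T p.1.1.1 + Φ p.1.1.2 = 0 := p.1.2
        rw [h0 p, map_zero, add_zero] at h1
        exact h1)
    refine Module.Finite.of_injective g fun p q hpq => ?_
    have h2 : p.1.1.1 = q.1.1.1 := congrArg Subtype.val hpq
    exact Subtype.ext (Subtype.ext (Prod.ext h2 ((h0 p).trans (h0 q).symm)))
  exact LinearMap.finite_of_finite_ker f

/-- A partition of unity by squares that is subordinate to a finite part of a given family of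
neighbourhoods. -/
theorem exists_finite_partition (𝕜 : Type*) [RCLike 𝕜] {X : Type*} [TopologicalSpace X]
    [CompactSpace X] [T2Space X] (U : X → Set X) (hU : ∀ x, IsOpen (U x)) (hx : ∀ x, x ∈ U x) :
    ∃ (t : Finset X) (ρ : t → X → 𝕜), (∀ i, Continuous (ρ i)) ∧ (∀ i, tsupport (ρ i) ⊆ U i) ∧
      ∀ x, ∑ i, ρ i x * ρ i x = 1 := by
  obtain ⟨t, ht⟩ := isCompact_univ.elim_finite_subcover U hU
    (fun x _ => Set.mem_iUnion.2 ⟨x, hx x⟩)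
  obtain ⟨f, hf⟩ := PartitionOfUnity.exists_isSubordinate (isClosed_univ (X := X))
    (fun i : t => U i) (fun i => hU i) (fun x hx => by
      obtain ⟨i, hi, h⟩ := Set.mem_iUnion₂.1 (ht hx)
      exact Set.mem_iUnion.2 ⟨⟨i, hi⟩, h⟩)
  -- Square roots make one factor `ρ` available on each side of a composition, as the embedding into
  -- a product bundle requires.
  refine ⟨t, fun i x => ((Real.sqrt (f i x) : ℝ) : 𝕜), fun i => ?_, fun i => ?_, fun x => ?_⟩
  · exact RCLike.continuous_ofReal.comp (Real.continuous_sqrt.comp (f i).continuous)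
  · refine (closure_mono fun x hx => ?_).trans (hf i)
    rw [Function.mem_support] at hx ⊢
    intro h
    simp [h] at hx
  · have h1 := f.sum_eq_one (Set.mem_univ x)
    rw [finsum_eq_sum_of_fintype] at h1
    simp_rw [← RCLike.ofReal_mul, Real.mul_self_sqrt (f.nonneg _ x)]
    rw [← RCLike.ofReal_sum, h1, RCLike.ofReal_one]

/-! ### Fredholm families and the local solution operator -/

namespace QuasiBundle

section LocallyTrivial

variable {𝕜 : Type u} [RCLike 𝕜] {X : Type w} [TopologicalSpace X]

namespace Chart

variable {Q : QuasiBundle.{u, v, w} 𝕜 X} {W : Type*} [AddCommGroup W] [Module 𝕜 W]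
  [TopologicalSpace W] {Z : Type*} [TopologicalSpace Z] {h : Z → X} {z₀ : Z}

theorem continuousAt_zero (c : Chart Q W) (hz : h z₀ ∈ c.source) (hh : ContinuousAt h z₀) :
    ContinuousAt (fun z => Q.pt (h z) 0) z₀ := by
  refine (c.continuousAt_iff hz).2 ⟨hh, ?_⟩
  simp only [map_zero]
  exact continuousAt_const

theorem continuousAt_add [ContinuousAdd W] (c : Chart Q W) (hz : h z₀ ∈ c.source)
    {a b : ∀ z, Q.Fib (h z)} (ha : ContinuousAt (fun z => Q.pt (h z) (a z)) z₀)
    (hb : ContinuousAt (fun z => Q.pt (h z) (b z)) z₀) :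
    ContinuousAt (fun z => Q.pt (h z) (a z + b z)) z₀ := by
  rw [c.continuousAt_iff hz] at ha hb ⊢
  simp only [map_add]
  exact ⟨ha.1, ha.2.add hb.2⟩

theorem continuousAt_smul [ContinuousSMul 𝕜 W] (c : Chart Q W) (hz : h z₀ ∈ c.source)
    {r : Z → 𝕜} {a : ∀ z, Q.Fib (h z)} (hr : ContinuousAt r z₀)
    (ha : ContinuousAt (fun z => Q.pt (h z) (a z)) z₀) :
    ContinuousAt (fun z => Q.pt (h z) (r z • a z)) z₀ := by
  rw [c.continuousAt_iff hz] at ha ⊢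
  simp only [map_smul]
  exact ⟨ha.1, hr.smul ha.2⟩

theorem continuousAt_sum [ContinuousAdd W] (c : Chart Q W) (hz : h z₀ ∈ c.source)
    (hh : ContinuousAt h z₀) {ι : Type*} (t : Finset ι) {a : ι → ∀ z, Q.Fib (h z)}
    (ha : ∀ i ∈ t, ContinuousAt (fun z => Q.pt (h z) (a i z)) z₀) :
    ContinuousAt (fun z => Q.pt (h z) (∑ i ∈ t, a i z)) z₀ := by
  refine (c.continuousAt_iff hz).2 ⟨hh, ?_⟩
  simp only [map_sum]
  exact tendsto_finsetSum _ fun i hi => c.continuousAt_coord hz (ha i hi)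

/-- A scalar multiple of a section is continuous if the section is continuous on the support of the
coefficient. -/
theorem continuousAt_smul_of_tsupport [ContinuousSMul 𝕜 W] (c : Chart Q W) (hz : h z₀ ∈ c.source)
    (hh : ContinuousAt h z₀) {r : X → 𝕜} (hr : Continuous r) {a : ∀ z, Q.Fib (h z)}
    (ha : h z₀ ∈ tsupport r → ContinuousAt (fun z => Q.pt (h z) (a z)) z₀) :
    ContinuousAt (fun z => Q.pt (h z) (r (h z) • a z)) z₀ := by
  by_cases hs : h z₀ ∈ tsupport r
  · exact c.continuousAt_smul hz (hr.continuousAt.comp hh) (ha hs)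
  · refine (c.continuousAt_zero hz hh).congr ?_
    filter_upwards [hh ((isClosed_tsupport r).isOpen_compl.mem_nhds hs)] with z hz
    rw [image_eq_zero_of_notMem_tsupport hz, zero_smul]

end Chart

section FredholmFamily

variable (F₁ : Type*) [NormedAddCommGroup F₁] [NormedSpace 𝕜 F₁]
  (F₂ : Type*) [NormedAddCommGroup F₂] [NormedSpace 𝕜 F₂]

/-- A family of linear maps between the fibres of locally trivial quasi-vector bundles that is
represented in local trivialisations by a norm-continuous family of Fredholm operators. -/
def IsFredholmFamily {A B : QuasiBundle.{u, v, w} 𝕜 X} (L : ∀ x, A.Fib x →ₗ[𝕜] B.Fib x) : Prop :=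
  ∀ x₀, ∃ (c₁ : Chart A F₁) (c₂ : Chart B F₂) (T : X → F₁ →L[𝕜] F₂),
    x₀ ∈ c₁.source ∧ x₀ ∈ c₂.source ∧ (∀ᶠ x in 𝓝 x₀, ContinuousAt T x) ∧
    (∀ᶠ x in 𝓝 x₀, ∀ u, T x u = c₂.coord x (L x (c₁.inv x u))) ∧
    -- Finiteness is demanded only at the centre `x₀`, since every point is the centre of its own
    -- charts.
    Module.Finite 𝕜 (T x₀).ker ∧
    ∃ W : Submodule 𝕜 F₂, Module.Finite 𝕜 W ∧ (T x₀).range ⊔ W = ⊤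

variable {F₁ F₂} {A B : QuasiBundle.{u, v, w} 𝕜 X} {L : ∀ x, A.Fib x →ₗ[𝕜] B.Fib x}

theorem IsFredholmFamily.continuousAt (hL : IsFredholmFamily F₁ F₂ L) {Z : Type*}
    [TopologicalSpace Z] {h : Z → X} {z₀ : Z} {a : ∀ z, A.Fib (h z)}
    (ha : ContinuousAt (fun z => A.pt (h z) (a z)) z₀) :
    ContinuousAt (fun z => B.pt (h z) (L (h z) (a z))) z₀ := by
  obtain ⟨c₁, c₂, T, h1, h2, hT, hTL, -⟩ := hL (h z₀)
  obtain ⟨hh, ha⟩ := (c₁.continuousAt_iff h1).1 ha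
  refine (c₂.continuousAt_iff h2).2 ⟨hh, ?_⟩
  refine ((ContinuousAt.comp hT.self_of_nhds hh).clm_apply ha).congr ?_
  filter_upwards [hh hTL, hh (c₁.isOpen_source.mem_nhds h1)] with z hz hz1
  simp only [Function.comp_apply]
  rw [hz, c₁.inv_coord _ hz1]

/-- Near each point, the equation `L u + v = f` with `u` in the fibre of `A` and `v` in the fibre of
a transversal subbundle `V` is solved by a continuous family of operators, which also parametrises
the solutions of the homogeneous equation. -/
theorem IsFredholmFamily.exists_local_solution [CompleteSpace F₁] [CompleteSpace F₂]
    (hL : IsFredholmFamily F₁ F₂ L) {V : ∀ x, Submodule 𝕜 (B.Fib x)}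
    (hV : (B.sub V).IsVectorBundle) (htr : ∀ x, LinearMap.range (L x) ⊔ V x = ⊤) (x₀ : X) :
    ∃ (c₁ : Chart A F₁) (c₂ : Chart B F₂) (n : ℕ) (d : Chart (B.sub V) (Fin n → 𝕜)) (m : ℕ)
      (C : F₁ × (Fin n → 𝕜) →L[𝕜] (Fin m → 𝕜))
      (R : X → F₂ × (Fin m → 𝕜) →L[𝕜] F₁ × (Fin n → 𝕜)), ∀ᶠ x in 𝓝 x₀,
      x ∈ c₁.source ∧ x ∈ c₂.source ∧ x ∈ d.source ∧ ContinuousAt R x ∧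
      (∀ u a, R x (c₂.coord x (L x (c₁.inv x u) + d.inv x a), C (u, a)) = (u, a)) ∧
      ∀ f k, c₂.coord x (L x (c₁.inv x (R x (f, k)).1) + d.inv x (R x (f, k)).2) = f ∧
        C (R x (f, k)) = k := by
  obtain ⟨c₁, c₂, T, h1, h2, hT, hTL, hker, -⟩ := hL x₀
  obtain ⟨n, d, hd⟩ := hV.exists_chart x₀
  -- The inclusion of `V` in charts. Its source is finite-dimensional, so pointwise continuity
  -- already gives norm continuity.
  let Φ : X → (Fin n → 𝕜) →L[𝕜] F₂ := fun x =>
    LinearMap.toContinuousLinearMap (c₂.coord x ∘ₗ (V x).subtype ∘ₗ d.inv x)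
  have hΦ : ∀ x ∈ c₂.source ∩ d.source, ContinuousAt Φ x := by
    intro x hx
    refine continuousAt_clm_apply.2 fun a => ?_
    refine c₂.continuousAt_coord (h := fun x => x) (a := fun x => (d.inv x a : B.Fib x)) hx.1 ?_
    exact continuousAt_sub_iff.1 (d.continuousAt_inv (h := fun x => x) (a := fun _ => a) hx.2
      continuousAt_id continuousAt_const)
  have hA : ∀ᶠ x in 𝓝 x₀, ContinuousAt (fun x => (T x).coprod (Φ x)) x := by
    filter_upwards [hT, (c₂.isOpen_source.inter d.isOpen_source).mem_nhds ⟨h2, hd⟩] with x hx hx'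
    exact ContinuousLinearMap.continuousAt_coprod hx (hΦ x hx')
  have hs : Function.Surjective ((T x₀).coprod (Φ x₀)) := by
    intro f
    have hf : c₂.inv x₀ f ∈ LinearMap.range (L x₀) ⊔ V x₀ := by rw [htr]; trivial
    obtain ⟨_, ⟨u, rfl⟩, v, hv, huv⟩ := Submodule.mem_sup.1 hf
    refine ⟨(c₁.coord x₀ u, d.coord x₀ ⟨v, hv⟩), ?_⟩
    have h3 : ((d.inv x₀ (d.coord x₀ ⟨v, hv⟩) : V x₀) : B.Fib x₀) = v := by rw [d.inv_coord _ hd]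
    rw [ContinuousLinearMap.coprod_apply, hTL.self_of_nhds, c₁.inv_coord _ h1]
    change _ + c₂.coord x₀ ((d.inv x₀ (d.coord x₀ ⟨v, hv⟩) : V x₀) : B.Fib x₀) = f
    rw [h3, ← map_add, huv, c₂.coord_inv _ h2]
  obtain ⟨m, C, R, hR⟩ := ContinuousLinearMap.exists_inverse_prod_near hA hs
    (ContinuousLinearMap.finite_ker_coprod _ _ hker)
  refine ⟨c₁, c₂, n, d, m, C, R, ?_⟩
  filter_upwards [hR, hTL, c₁.isOpen_source.mem_nhds h1, c₂.isOpen_source.mem_nhds h2,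
    d.isOpen_source.mem_nhds hd] with x ⟨hRx, hl, hr⟩ hT h1 h2 hd
  have key : ∀ u a, (T x).coprod (Φ x) (u, a) =
      c₂.coord x (L x (c₁.inv x u) + d.inv x a) := fun u a => by
    rw [ContinuousLinearMap.coprod_apply, hT, map_add]
    rfl
  refine ⟨h1, h2, hd, hRx, fun u a => ?_, fun f k => ?_⟩
  · rw [← key]; exact hl (u, a)
  · rw [← key]; exact hr f k

end FredholmFamily

end LocallyTrivial

end QuasiBundle

/-- Fibres of a quasi-vector bundle are declared only as additive monoids, so negation is expressed
by the scalar `-1`. -/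
theorem add_neg_one_smul_self {𝕜 M : Type*} [Ring 𝕜] [AddCommMonoid M] [Module 𝕜 M] (a : M) :
    a + (-1 : 𝕜) • a = 0 := by
  nth_rewrite 1 [← one_smul 𝕜 a]
  rw [← add_smul, add_neg_cancel, zero_smul]

theorem eq_neg_one_smul_of_add_eq_zero {𝕜 M : Type*} [Ring 𝕜] [AddCommMonoid M] [Module 𝕜 M]
    {a b : M} (h : a + b = 0) : a = (-1 : 𝕜) • b := by
  have := congrArg (· + (-1 : 𝕜) • b) h
  simpa only [add_assoc, add_neg_one_smul_self, add_zero, zero_add] using this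

/-! ### The bundle `E(L, V)` and right inverses modulo `V` -/

namespace QuasiBundle

section FredholmFamily

variable {𝕜 : Type u} [RCLike 𝕜] {X : Type w} [TopologicalSpace X]
  {F₁ : Type*} [NormedAddCommGroup F₁] [NormedSpace 𝕜 F₁] [CompleteSpace F₁]
  {F₂ : Type*} [NormedAddCommGroup F₂] [NormedSpace 𝕜 F₂] [CompleteSpace F₂]
  {A B : QuasiBundle.{u, v, w} 𝕜 X} {L : ∀ x, A.Fib x →ₗ[𝕜] B.Fib x}

/-- The preimage of a transversal subbundle under a Fredholm morphism is a vector bundle. -/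
theorem IsFredholmFamily.isVectorBundle_comap (hL : IsFredholmFamily F₁ F₂ L)
    {V : ∀ x, Submodule 𝕜 (B.Fib x)} (hV : (B.sub V).IsVectorBundle)
    (htr : ∀ x, LinearMap.range (L x) ⊔ V x = ⊤) :
    (A.sub fun x => (V x).comap (L x)).IsVectorBundle := by
  classical
  refine IsVectorBundle.of_charts fun x₀ => ?_
  obtain ⟨c₁, c₂, n, d, m, C, R, hR⟩ := hL.exists_local_solution hV htr x₀
  obtain ⟨U, hU, hUo, hxU⟩ := eventually_nhds_iff.1 hR
  have hzero : ∀ x ∈ U, ∀ k, L x (c₁.inv x (R x (0, k)).1) =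
      (-1 : 𝕜) • ((d.inv x (R x (0, k)).2 : V x) : B.Fib x) := by
    intro x hx k
    obtain ⟨h1, h2, hd, hRx, hl, hr⟩ := hU x hx
    refine eq_neg_one_smul_of_add_eq_zero (c₂.coord_injective h2 ?_)
    rw [(hr 0 k).1, map_zero]
  -- `R x (0, k)` runs through the solutions of `L u + v = 0`; then `v = -L u` lies in `V`, so the
  -- component `u` is exactly a vector of `E(L, V)`.
  let I : ∀ x, (Fin m → 𝕜) →ₗ[𝕜] A.Fib x := fun x =>
    c₁.inv x ∘ₗ LinearMap.fst 𝕜 F₁ (Fin n → 𝕜) ∘ₗ (R x : _ →ₗ[𝕜] _) ∘ₗ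
      LinearMap.inr 𝕜 F₂ (Fin m → 𝕜)
  have hmem : ∀ x ∈ U, ∀ k, I x k ∈ (V x).comap (L x) := by
    intro x hx k
    rw [Submodule.mem_comap, show L x (I x k) = _ from hzero x hx k]
    exact (V x).smul_mem _ (d.inv x (R x (0, k)).2).2
  let LV : ∀ x, (V x).comap (L x) →ₗ[𝕜] V x := fun x =>
    (L x ∘ₗ ((V x).comap (L x)).subtype).codRestrict (V x) fun u => u.2
  have hI : ∀ x, ∀ hx : x ∈ U, ∀ k, LV x ⟨I x k, hmem x hx k⟩ =
      (-1 : 𝕜) • d.inv x (R x (0, k)).2 := fun x hx k => Subtype.ext (hzero x hx k)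
  refine ⟨m, {
    source := U
    isOpen_source := hUo
    coord := fun x => (C : _ →ₗ[𝕜] _) ∘ₗ (c₁.coord x ∘ₗ ((V x).comap (L x)).subtype).prod
      ((-1 : 𝕜) • (d.coord x ∘ₗ LV x))
    inv := fun x => if hx : x ∈ U then (I x).codRestrict _ (hmem x hx) else 0
    inv_coord := ?_
    coord_inv := ?_
    continuousOn_coord := ?_
    continuousOn_inv := ?_ }, hxU⟩
  · intro x hx u
    obtain ⟨h1, h2, hd, hRx, hl, hr⟩ := hU x hx
    rw [dif_pos hx]
    refine Subtype.ext ?_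
    have h3 := hl (c₁.coord x u) ((-1 : 𝕜) • d.coord x (LV x u))
    rw [c₁.inv_coord _ h1, map_smul, d.inv_coord _ hd, Submodule.coe_smul] at h3
    have h4 : L x u + (-1 : 𝕜) • ((LV x u : V x) : B.Fib x) = 0 := add_neg_one_smul_self _
    rw [h4, map_zero] at h3
    change c₁.inv x (R x (0, C (c₁.coord x u, (-1 : 𝕜) • d.coord x (LV x u)))).1 = u
    rw [h3, c₁.inv_coord _ h1]
  · intro x hx k
    obtain ⟨h1, h2, hd, hRx, hl, hr⟩ := hU x hx
    rw [dif_pos hx]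
    change C (c₁.coord x (c₁.inv x (R x (0, k)).1),
      (-1 : 𝕜) • d.coord x (LV x ⟨I x k, hmem x hx k⟩)) = k
    rw [hI x hx k, c₁.coord_inv _ h1, map_smul, d.coord_inv _ hd, smul_smul, neg_one_mul, neg_neg,
      one_smul]
    exact (hr 0 k).2
  · intro p hp
    obtain ⟨h1, h2, hd, hRx, hl, hr⟩ := hU p.1 hp
    refine ContinuousAt.continuousWithinAt ?_
    have hval : ContinuousAt (fun p : (A.sub fun x => (V x).comap (L x)).Total =>
      A.pt p.1 (p.2 : A.Fib p.1)) p := (continuous_sub_val _).continuousAt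
    have e1 := c₁.continuousAt_coord (z₀ := p) h1 hval
    have e2 : ContinuousAt (fun p : (A.sub fun x => (V x).comap (L x)).Total =>
      (B.sub V).pt p.1 (LV p.1 p.2)) p := continuousAt_sub_iff.2 (hL.continuousAt hval)
    have e3 := d.continuousAt_coord (z₀ := p) hd e2
    exact C.continuous.continuousAt.comp (e1.prodMk (e3.const_smul (-1 : 𝕜)))
  · intro q hq
    obtain ⟨h1, h2, hd, hRx, hl, hr⟩ := hU q.1 hq.1
    refine ContinuousAt.continuousWithinAt (continuousAt_sub_iff.2 ?_)
    have e1 : ContinuousAt (fun q : X × (Fin m → 𝕜) => (R q.1 (0, q.2)).1) q :=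
      (ContinuousAt.clm_apply (ContinuousAt.comp (f := Prod.fst) hRx continuousAt_fst)
        (continuousAt_const.prodMk continuousAt_snd)).fst
    refine (c₁.continuousAt_inv (h := Prod.fst) h1 continuousAt_fst e1).congr ?_
    filter_upwards [continuousAt_fst (hUo.mem_nhds hq.1)] with z hz
    have hz : z.1 ∈ U := hz
    rw [dif_pos hz]
    rfl

/-- A Fredholm morphism has a continuous right inverse modulo a transversal subbundle. -/
theorem IsFredholmFamily.exists_parametrix [CompactSpace X] [T2Space X]
    (hL : IsFredholmFamily F₁ F₂ L)
    {V : ∀ x, Submodule 𝕜 (B.Fib x)} (hV : (B.sub V).IsVectorBundle)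
    (htr : ∀ x, LinearMap.range (L x) ⊔ V x = ⊤) :
    ∃ τ : ∀ x, B.Fib x →ₗ[𝕜] A.Fib x, Continuous (totalMap (fun x => τ x) : B.Total → A.Total) ∧
      ∀ x b, L x (τ x b) + b ∈ V x := by
  have hloc : ∀ x₀, ∃ (U : Set X) (τ : ∀ x, B.Fib x →ₗ[𝕜] A.Fib x), IsOpen U ∧ x₀ ∈ U ∧
      (∀ p : B.Total, p.1 ∈ U → ContinuousAt (fun p : B.Total => A.pt p.1 (τ p.1 p.2)) p) ∧
      ∀ x ∈ U, ∀ b, L x (τ x b) + b ∈ V x := by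
    intro x₀
    obtain ⟨c₁, c₂, n, d, m, C, R, hR⟩ := hL.exists_local_solution hV htr x₀
    obtain ⟨U, hU, hUo, hxU⟩ := eventually_nhds_iff.1 hR
    -- Solving `L u + v = b` by `R` and putting `τ b = -u` yields `L (τ b) + b = v ∈ V`.
    refine ⟨U, fun x => (-1 : 𝕜) • (c₁.inv x ∘ₗ LinearMap.fst 𝕜 F₁ (Fin n → 𝕜) ∘ₗ
      (R x : _ →ₗ[𝕜] _) ∘ₗ LinearMap.inl 𝕜 F₂ (Fin m → 𝕜) ∘ₗ c₂.coord x), hUo, hxU, ?_, ?_⟩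
    · intro p hp
      obtain ⟨h1, h2, hd, hRx, hl, hr⟩ := hU p.1 hp
      have e0 : ContinuousAt (fun p : B.Total => p.1) p := B.continuous_proj.continuousAt
      have e1 := c₂.continuousAt_coord (z₀ := p) (h := fun p : B.Total => p.1)
        (a := fun p => p.2) h2 continuousAt_id
      have e2 : ContinuousAt (fun p : B.Total => (R p.1 (c₂.coord p.1 p.2, 0)).1) p :=
        (ContinuousAt.clm_apply (ContinuousAt.comp (f := fun p : B.Total => p.1) hRx e0)
          (e1.prodMk continuousAt_const)).fst
      exact c₁.continuousAt_smul h1 (r := fun _ => -1) continuousAt_const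
        (c₁.continuousAt_inv (h := fun p : B.Total => p.1) h1 e0 e2)
    · intro x hx b
      obtain ⟨h1, h2, hd, hRx, hl, hr⟩ := hU x hx
      have h3 : L x (c₁.inv x (R x (c₂.coord x b, 0)).1) +
          d.inv x (R x (c₂.coord x b, 0)).2 = b :=
        c₂.coord_injective h2 (hr (c₂.coord x b) 0).1
      rw [LinearMap.smul_apply, map_smul]
      change (-1 : 𝕜) • L x (c₁.inv x (R x (c₂.coord x b, 0)).1) + b ∈ V x
      nth_rewrite 2 [← h3]
      rw [← add_assoc, add_comm ((-1 : 𝕜) • _), add_neg_one_smul_self, zero_add]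
      exact Subtype.prop _
  choose U τ hUo hxU hc hτ using hloc
  obtain ⟨t, ρ, hρ, hsupp, hsum⟩ := exists_finite_partition 𝕜 U hUo hxU
  -- The condition on `τ` is affine, hence stable under weights with sum one; where a local `τ i`
  -- may fail it, its weight vanishes.
  refine ⟨fun x => ∑ i, (ρ i x * ρ i x) • τ i x, ?_, fun x b => ?_⟩
  · refine continuous_iff_continuousAt.2 fun p => ?_
    obtain ⟨c, -, -, hp, -⟩ := hL p.1
    have e0 : ContinuousAt (fun p : B.Total => p.1) p := B.continuous_proj.continuousAt
    have e1 := c.continuousAt_sum (z₀ := p) (h := fun p : B.Total => p.1) hp e0 Finset.univ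
      (a := fun i p => ρ i p.1 • ρ i p.1 • τ i p.1 p.2) fun i _ =>
        c.continuousAt_smul hp ((hρ i).continuousAt.comp e0)
          (c.continuousAt_smul_of_tsupport hp e0 (hρ i) fun h => hc i p (hsupp i h))
    refine e1.congr (Filter.Eventually.of_forall fun p => ?_)
    simp only [totalMap, LinearMap.sum_apply, LinearMap.smul_apply, smul_smul]
    rfl
  · have h1 : L x ((∑ i, (ρ i x * ρ i x) • τ i x) b) + b =
        ∑ i, (ρ i x * ρ i x) • (L x (τ i x b) + b) := by
      simp only [LinearMap.sum_apply, LinearMap.smul_apply, map_sum, map_smul, smul_add,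
        Finset.sum_add_distrib, ← Finset.sum_smul, hsum, one_smul]
    rw [h1]
    refine Submodule.sum_mem _ fun i _ => ?_
    by_cases h : ρ i x = 0
    · simp [h]
    · exact Submodule.smul_mem _ _ (hτ i x (hsupp i (subset_tsupport _ h)) b)

end FredholmFamily

end QuasiBundle

/-! ### Exchanging two transversal subbundles -/

section Exchange

variable {𝕜 M N : Type*} [CommRing 𝕜] [AddCommMonoid M] [Module 𝕜 M] [AddCommMonoid N] [Module 𝕜 N]
  {L : M →ₗ[𝕜] N} {V V' : Submodule 𝕜 N} {σ σ' : N →ₗ[𝕜] M}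

/-- For two subspaces `V` and `V'` and right inverses `-σ` and `-σ'` of `L` modulo `V` and `V'`, the
natural map `L⁻¹ V × V' → L⁻¹ V' × V`. -/
def exchangeMap (hσ : ∀ b, L (σ b) + b ∈ V) (hσ' : ∀ b, L (σ' b) + b ∈ V') :
    (V.comap L × V') →ₗ[𝕜] (V'.comap L × V) :=
  -- The pair `(u, v')` goes to the triple `(w, b, v')` with `w = u + σ v'` and `L w + b + v' = 0`.
  -- Such triples are symmetric in the two subspaces, and removing `σ' b` from `w` leaves a vector
  -- that `L` sends into `V'`.
  let w : (V.comap L × V') →ₗ[𝕜] M :=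
    (V.comap L).subtype ∘ₗ LinearMap.fst 𝕜 _ _ + σ ∘ₗ V'.subtype ∘ₗ LinearMap.snd 𝕜 _ _
  let b : (V.comap L × V') →ₗ[𝕜] N :=
    (-1 : 𝕜) • (L ∘ₗ w + V'.subtype ∘ₗ LinearMap.snd 𝕜 _ _)
  have hb : ∀ p, b p ∈ V := fun p => V.smul_mem _ <| by
    have h : L (p.1 + σ p.2) + (p.2 : N) = L p.1 + (L (σ p.2) + p.2) := by
      rw [map_add, add_assoc]
    change L (p.1 + σ p.2) + (p.2 : N) ∈ V
    rw [h]
    exact V.add_mem p.1.2 (hσ p.2)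
  (LinearMap.codRestrict _ (w + (-1 : 𝕜) • (σ' ∘ₗ b)) fun p => by
    have h : L (w p + (-1 : 𝕜) • σ' (b p)) = (-1 : 𝕜) • (L (σ' (b p)) + b p) + (-1 : 𝕜) • p.2 := by
      have h1 : b p = (-1 : 𝕜) • (L (w p) + p.2) := rfl
      have h2 : L (w p) = (-1 : 𝕜) • b p + (-1 : 𝕜) • p.2 := by rw [h1]; module
      rw [map_add, map_smul, h2]
      module
    change L (w p + (-1 : 𝕜) • σ' (b p)) ∈ V'
    rw [h]
    exact V'.add_mem (V'.smul_mem _ (hσ' _)) (V'.smul_mem _ p.2.2)).prod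
  (LinearMap.codRestrict _ b hb)

variable (hσ : ∀ b, L (σ b) + b ∈ V) (hσ' : ∀ b, L (σ' b) + b ∈ V')

theorem exchangeMap_snd (p : V.comap L × V') :
    ((exchangeMap hσ hσ' p).2 : N) = (-1 : 𝕜) • (L (p.1 + σ p.2) + p.2) := rfl

theorem exchangeMap_fst (p : V.comap L × V') :
    ((exchangeMap hσ hσ' p).1 : M) =
      (p.1 + σ p.2) + (-1 : 𝕜) • σ' (exchangeMap hσ hσ' p).2 := rfl

/-- Both directions pass through the same vector `w`: `h1` recovers it from the image, after which
`v'` and `u` are determined. -/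
theorem exchangeMap_exchangeMap (p : V.comap L × V') :
    exchangeMap hσ' hσ (exchangeMap hσ hσ' p) = p := by
  set q := exchangeMap hσ hσ' p with hq
  have h1 : (q.1 : M) + σ' q.2 = p.1 + σ p.2 := by rw [hq, exchangeMap_fst]; module
  have h2 : ((exchangeMap hσ' hσ q).2 : N) = p.2 := by
    rw [exchangeMap_snd, h1, hq, exchangeMap_snd]; module
  refine Prod.ext (Subtype.ext ?_) (Subtype.ext h2)
  rw [exchangeMap_fst, h1, h2]; module

end Exchange

namespace QuasiBundle

section FredholmFamily

variable {𝕜 : Type u} [RCLike 𝕜] {X : Type w} [TopologicalSpace X]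
  {F₁ : Type*} [NormedAddCommGroup F₁] [NormedSpace 𝕜 F₁]
  {F₂ : Type*} [NormedAddCommGroup F₂] [NormedSpace 𝕜 F₂]
  {A B : QuasiBundle.{u, v, w} 𝕜 X} {L : ∀ x, A.Fib x →ₗ[𝕜] B.Fib x}

theorem IsFredholmFamily.continuous_exchangeMap (hL : IsFredholmFamily F₁ F₂ L)
    {V V' : ∀ x, Submodule 𝕜 (B.Fib x)} {σ σ' : ∀ x, B.Fib x →ₗ[𝕜] A.Fib x}
    (hc : Continuous (totalMap (fun x => σ x) : B.Total → A.Total))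
    (hc' : Continuous (totalMap (fun x => σ' x) : B.Total → A.Total))
    (hσ : ∀ x b, L x (σ x b) + b ∈ V x) (hσ' : ∀ x b, L x (σ' x b) + b ∈ V' x) :
    Continuous (totalMap (fun x => exchangeMap (hσ x) (hσ' x)) :
      ((A.sub fun x => (V x).comap (L x)).sum (B.sub V')).Total →
      ((A.sub fun x => (V' x).comap (L x)).sum (B.sub V)).Total) := by
  let S := ((A.sub fun x => (V x).comap (L x)).sum (B.sub V'))
  have hu : Continuous (fun p : S.Total => A.pt p.1 (p.2.1 : A.Fib p.1)) :=
    (continuous_sub_val _).comp (continuous_sum_fst _ _)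
  have hv : Continuous (fun p : S.Total => B.pt p.1 (p.2.2 : B.Fib p.1)) :=
    (continuous_sub_val _).comp (continuous_sum_snd _ _)
  have hw : Continuous (fun p : S.Total => A.pt p.1 (p.2.1 + σ p.1 p.2.2)) := by
    refine continuous_iff_continuousAt.2 fun p => ?_
    obtain ⟨c, -, -, hp, -⟩ := hL p.1
    exact c.continuousAt_add hp hu.continuousAt (hc.comp hv).continuousAt
  have hb : Continuous (fun p : S.Total =>
      B.pt p.1 ((exchangeMap (hσ p.1) (hσ' p.1) p.2).2 : B.Fib p.1)) := by
    refine continuous_iff_continuousAt.2 fun p => ?_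
    obtain ⟨-, c, -, -, hp, -⟩ := hL p.1
    exact c.continuousAt_smul hp (r := fun _ => (-1 : 𝕜)) continuousAt_const
      (c.continuousAt_add hp (hL.continuousAt hw.continuousAt) hv.continuousAt)
  have ha : Continuous (fun p : S.Total =>
      A.pt p.1 ((exchangeMap (hσ p.1) (hσ' p.1) p.2).1 : A.Fib p.1)) := by
    refine continuous_iff_continuousAt.2 fun p => ?_
    obtain ⟨c, -, -, hp, -⟩ := hL p.1
    exact c.continuousAt_add hp hw.continuousAt
      (c.continuousAt_smul hp (r := fun _ => (-1 : 𝕜)) continuousAt_const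
        (hc'.comp hb).continuousAt)
  exact continuous_sum_iff.2
    ⟨continuous_iff_continuousAt.2 fun p => continuousAt_sub_iff.2 ha.continuousAt,
      continuous_iff_continuousAt.2 fun p => continuousAt_sub_iff.2 hb.continuousAt⟩

/-- For two transversal subbundles `V` and `V'` of the target of a Fredholm morphism `L`,
`L⁻¹ V ⊕ V' ≅ L⁻¹ V' ⊕ V`. -/
theorem IsFredholmFamily.nonempty_iso_exchange [CompactSpace X] [T2Space X]
    [CompleteSpace F₁] [CompleteSpace F₂]
    (hL : IsFredholmFamily F₁ F₂ L) {V V' : ∀ x, Submodule 𝕜 (B.Fib x)}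
    (hV : (B.sub V).IsVectorBundle) (htr : ∀ x, LinearMap.range (L x) ⊔ V x = ⊤)
    (hV' : (B.sub V').IsVectorBundle) (htr' : ∀ x, LinearMap.range (L x) ⊔ V' x = ⊤) :
    Nonempty (Iso ((A.sub fun x => (V x).comap (L x)).sum (B.sub V'))
      ((A.sub fun x => (V' x).comap (L x)).sum (B.sub V))) := by
  obtain ⟨σ, hc, hσ⟩ := hL.exists_parametrix hV htr
  obtain ⟨σ', hc', hσ'⟩ := hL.exists_parametrix hV' htr'
  exact ⟨{
    equiv := fun x => LinearEquiv.ofLinearMap (exchangeMap (hσ x) (hσ' x))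
      (exchangeMap (hσ' x) (hσ x)) (LinearMap.ext (exchangeMap_exchangeMap (hσ' x) (hσ x)))
      (LinearMap.ext (exchangeMap_exchangeMap (hσ x) (hσ' x)))
    continuous_equiv := hL.continuous_exchangeMap hc hc' hσ hσ'
    continuous_symm := hL.continuous_exchangeMap hc' hc hσ' hσ }⟩

end FredholmFamily

end QuasiBundle

/-! ### Homotopy invariance of vector bundles -/

namespace QuasiBundle

section Homotopy

variable {𝕜 : Type u} [RCLike 𝕜] {X : Type w} [TopologicalSpace X]

/-- A vector bundle over a compact Hausdorff space is a direct summand of a product bundle. -/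
theorem IsVectorBundle.exists_embedding [CompactSpace X] [T2Space X]
    {Q : QuasiBundle.{u, v, w} 𝕜 X} (hQ : Q.IsVectorBundle) :
    ∃ (t : Finset X) (n : t → ℕ) (J : ∀ x, Q.Fib x →ₗ[𝕜] (∀ i, Fin (n i) → 𝕜))
      (G : ∀ x, (∀ i, Fin (n i) → 𝕜) →ₗ[𝕜] Q.Fib x),
      Continuous (fun p : Q.Total => J p.1 p.2) ∧
      Continuous (fun q : X × (∀ i, Fin (n i) → 𝕜) => Q.pt q.1 (G q.1 q.2)) ∧
      ∀ x a, G x (J x a) = a := by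
  choose n c hc using hQ.exists_chart
  obtain ⟨t, ρ, hρ, hsupp, hsum⟩ := exists_finite_partition 𝕜 (fun x => (c x).source)
    (fun x => (c x).isOpen_source) hc
  -- `J` and `G` each carry one factor `ρ i`, so `G ∘ J` is multiplication by the sum of the
  -- squares, which is one.
  refine ⟨t, fun i => n i, fun x => LinearMap.pi fun i => ρ i x • (c i).coord x,
    fun x => ∑ i, ρ i x • ((c i).inv x ∘ₗ LinearMap.proj i), ?_, ?_, fun x a => ?_⟩
  · refine continuous_pi fun i => continuous_iff_continuousAt.2 fun p => ?_
    have e0 : ContinuousAt (fun p : Q.Total => p.1) p := Q.continuous_proj.continuousAt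
    by_cases hs : p.1 ∈ tsupport (ρ i)
    · exact ((hρ i).continuousAt.comp e0).smul ((c i).continuousAt_coord (z₀ := p)
        (h := fun p : Q.Total => p.1) (a := fun p => p.2) (hsupp i hs) continuousAt_id)
    · refine (continuousAt_const (y := (0 : Fin (n i) → 𝕜))).congr ?_
      filter_upwards [e0 ((isClosed_tsupport (ρ i)).isOpen_compl.mem_nhds hs)] with z hz
      have hz : z.1 ∉ tsupport (ρ i) := hz
      simp [image_eq_zero_of_notMem_tsupport hz]
  · refine continuous_iff_continuousAt.2 fun q => ?_
    have e1 := (c q.1).continuousAt_sum (z₀ := q)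
      (h := fun q : X × (∀ i : t, Fin (n i) → 𝕜) => q.1) (hc _) continuousAt_fst Finset.univ
      (a := fun i q => ρ i q.1 • (c i).inv q.1 (q.2 i)) fun i _ =>
        (c q.1).continuousAt_smul_of_tsupport (hc _) continuousAt_fst (hρ i) fun h =>
          (c i).continuousAt_inv (hsupp i h) continuousAt_fst (by fun_prop)
    refine e1.congr (Filter.Eventually.of_forall fun p => ?_)
    simp only [LinearMap.sum_apply, LinearMap.smul_apply]
    rfl
  · have h1 : ∀ i, ρ i x • (c i).inv x (ρ i x • (c i).coord x a) = (ρ i x * ρ i x) • a := by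
      intro i
      by_cases h : ρ i x = 0
      · simp [h]
      · rw [map_smul, (c i).inv_coord x (hsupp i (subset_tsupport _ h)), smul_smul]
    simp only [LinearMap.sum_apply, LinearMap.smul_apply, LinearMap.comp_apply, LinearMap.proj_apply,
      LinearMap.pi_apply, h1, ← Finset.sum_smul, hsum, one_smul]

variable {Q : QuasiBundle.{u, v, w} 𝕜 X} {W : Type*} [NormedAddCommGroup W] [NormedSpace 𝕜 W]
  {J : ∀ x, Q.Fib x →ₗ[𝕜] W} {G : ∀ x, W →ₗ[𝕜] Q.Fib x}
  {P : X → W →L[𝕜] W}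

/-- The operator that intertwines two projections if it is invertible. -/
def intertwiner (P P' : W →L[𝕜] W) : W →L[𝕜] W := P' * P + (1 - P') * (1 - P)

theorem nonempty_iso_pullback_of_isUnit [CompleteSpace W]
    (hJ : Continuous (fun p : Q.Total => J p.1 p.2))
    (hG : Continuous (fun q : X × W => Q.pt q.1 (G q.1 q.2)))
    (hGJ : ∀ x a, G x (J x a) = a) (hP : Continuous P) (hPJ : ∀ x b, P x b = J x (G x b))
    {Y : Type u'} [TopologicalSpace Y] {f g : Y → X} (hf : Continuous f) (hg : Continuous g)
    (hU : ∀ y, IsUnit (intertwiner (P (f y)) (P (g y)))) :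
    Nonempty (Iso (Q.pullback f) (Q.pullback g)) := by
  let T : Y → W →L[𝕜] W := fun y => intertwiner (P (f y)) (P (g y))
  let R : Y → W →L[𝕜] W := fun y => Ring.inverse (T y)
  have hT : Continuous T := by
    have h1 := hP.comp hf
    have h2 := hP.comp hg
    exact (h2.mul h1).add ((continuous_const.sub h2).mul (continuous_const.sub h1))
  have hR : Continuous R := continuous_iff_continuousAt.2 fun y => by
    obtain ⟨a, ha⟩ := hU y
    have := NormedRing.inverse_continuousAt a
    rw [ha] at this
    exact ContinuousAt.comp (f := T) this hT.continuousAt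
  have hRT : ∀ y b, R y (T y b) = b := fun y b =>
    DFunLike.congr_fun (Ring.inverse_mul_cancel _ (hU y)) b
  have hTR : ∀ y b, T y (R y b) = b := fun y b =>
    DFunLike.congr_fun (Ring.mul_inverse_cancel _ (hU y)) b
  have hTb : ∀ y b, T y b = P (g y) (P (f y) b) +
      ((b - P (f y) b) - P (g y) (b - P (f y) b)) := fun y b => rfl
  refine ⟨{
    -- On the image of `P (f y)` the intertwiner acts as `P (g y)`, which in the fibres of `Q` is `G
    -- (g y) ∘ J (f y)`; its inverse therefore comes from `R`.
    equiv := fun y => LinearEquiv.ofLinearMap (G (g y) ∘ₗ J (f y))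
      (G (f y) ∘ₗ (R y : W →ₗ[𝕜] W) ∘ₗ J (g y)) (LinearMap.ext fun a => ?_)
      (LinearMap.ext fun a => ?_)
    continuous_equiv := ?_
    continuous_symm := ?_ }⟩
  · change G (g y) (J (f y) (G (f y) (R y (J (g y) a)))) = a
    have hidem : ∀ x b, P x (P x b) = P x b := fun x b => by simp only [hPJ, hGJ]
    -- Applying `P (g y)` kills the complementary summand of the intertwiner, because `P (g y)` is
    -- idempotent.
    have h1 := congrArg (P (g y)) (hTR y (J (g y) a))
    rw [hTb, map_add, map_sub, hidem, hidem, sub_self, add_zero] at h1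
    simp only [hPJ, hGJ] at h1
    have h2 := congrArg (G (g y)) h1
    rwa [hGJ, hGJ] at h2
  · change G (f y) (R y (J (g y) (G (g y) (J (f y) a)))) = a
    have h1 : T y (J (f y) a) = J (g y) (G (g y) (J (f y) a)) := by
      rw [hTb]
      simp only [hPJ, hGJ, sub_self, map_zero, add_zero]
    rw [← h1, hRT, hGJ]
  · refine continuous_pullback_iff.2 ⟨QuasiBundle.continuous_proj _, ?_⟩
    exact hG.comp ((hg.comp (QuasiBundle.continuous_proj _)).prodMk
      (hJ.comp (continuous_pullback_lift f Q)))
  · refine continuous_pullback_iff.2 ⟨QuasiBundle.continuous_proj _, ?_⟩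
    exact hG.comp ((hf.comp (QuasiBundle.continuous_proj _)).prodMk
      ((hR.comp (QuasiBundle.continuous_proj _)).clm_apply
        (hJ.comp (continuous_pullback_lift g Q))))

/-- Pullbacks of a vector bundle under homotopic maps are isomorphic. -/
theorem IsVectorBundle.nonempty_iso_of_homotopic [CompactSpace X] [T2Space X]
    {Q : QuasiBundle.{u, v, w} 𝕜 X} (hQ : Q.IsVectorBundle) {Y : Type u'} [TopologicalSpace Y]
    [CompactSpace Y] {f g : C(Y, X)} (h : f.Homotopic g) :
    Nonempty (Iso (Q.pullback f) (Q.pullback g)) := by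
  obtain ⟨H⟩ := h
  obtain ⟨t, n, J, G, hJ, hG, hGJ⟩ := hQ.exists_embedding
  let P : X → (∀ i, Fin (n i) → 𝕜) →L[𝕜] (∀ i, Fin (n i) → 𝕜) := fun x =>
    LinearMap.toContinuousLinearMap (J x ∘ₗ G x)
  have hPJ : ∀ x b, P x b = J x (G x b) := fun x b => rfl
  have hP : Continuous P := continuous_clm_apply.2 fun b =>
    hJ.comp (hG.comp (continuous_id.prodMk continuous_const))
  have hPP : ∀ x, P x * P x = P x := fun x => by
    ext1 b
    change P x (P x b) = P x b
    simp only [hPJ, hGJ]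
  let r : unitInterval → unitInterval → Prop := fun s s' =>
    Nonempty (Iso (Q.pullback fun y => H (s, y)) (Q.pullback fun y => H (s', y)))
  have hHc : ∀ s, Continuous fun y => H (s, y) := fun s => by fun_prop
  -- At `s' = s` the intertwiner is the identity and units are open; compactness of `Y` makes the
  -- neighbourhood of `s` independent of `y`.
  have hloc : ∀ s, ∀ᶠ s' in 𝓝 s, r s s' := by
    intro s
    have h1 : ∀ y ∈ (Set.univ : Set Y), ∀ᶠ p : unitInterval × Y in 𝓝 (s, y),
        IsUnit (intertwiner (P (H (s, p.2))) (P (H (p.1, p.2)))) := by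
      intro y _
      have hc : Continuous fun p : unitInterval × Y => intertwiner (P (H (s, p.2))) (P (H p)) := by
        have a1 : Continuous fun p : unitInterval × Y => P (H (s, p.2)) := by fun_prop
        have a2 : Continuous fun p : unitInterval × Y => P (H p) := by fun_prop
        exact (a2.mul a1).add ((continuous_const.sub a2).mul (continuous_const.sub a1))
      refine hc.continuousAt (Units.isOpen.mem_nhds ?_)
      have h2 : intertwiner (P (H (s, y))) (P (H (s, y))) = 1 := by
        rw [intertwiner, mul_sub, mul_one, sub_mul, one_mul, hPP, sub_self, sub_zero,
          add_sub_cancel]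
      exact h2 ▸ isUnit_one
    filter_upwards [isCompact_univ.eventually_forall_of_forall_eventually
      (P := fun s' y => IsUnit (intertwiner (P (H (s, y))) (P (H (s', y))))) h1] with s' hs'
    exact nonempty_iso_pullback_of_isUnit hJ hG hGJ hP hPJ (hHc s) (hHc s') fun y =>
      hs' y (Set.mem_univ y)
  have hr : r 0 1 := by
    have : Std.Symm r := ⟨fun a b ⟨e⟩ => ⟨e.symm⟩⟩
    -- An equivalence relation on the connected unit interval that holds locally holds for every
    -- pair of points.
    exact PreconnectedSpace.induction₂ r hloc ⟨fun a b c ⟨e⟩ ⟨e'⟩ => ⟨e.trans e'⟩⟩ 0 1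
  have e0 : (fun y => H (0, y)) = f := funext H.apply_zero
  have e1 : (fun y => H (1, y)) = g := funext H.apply_one
  rwa [← e0, ← e1]

end Homotopy

end QuasiBundle

/-! ### Existence of transversal subbundles -/

/-- In an infinite-dimensional Banach space, every open ball contains a point that avoids a given
sequence of compact sets. -/
theorem exists_mem_ball_forall_notMem_of_isCompact (𝕜 : Type*) [RCLike 𝕜] {F : Type*}
    [NormedAddCommGroup F] [NormedSpace 𝕜 F] [CompleteSpace F] (hF : ¬ FiniteDimensional 𝕜 F)
    {K : ℕ → Set F} (hK : ∀ n, IsCompact (K n)) (e₀ : F) {δ : ℝ} (hδ : 0 < δ) :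
    ∃ e, ‖e - e₀‖ < δ ∧ ∀ n, e ∉ K n := by
  have hd : ∀ n, Dense (K n)ᶜ := by
    intro n
    rw [← interior_eq_empty_iff_dense_compl, ← Set.not_nonempty_iff_eq_empty]
    rintro ⟨y, hy⟩
    obtain ⟨r, hr, hyr⟩ := Metric.nhds_basis_closedBall.mem_iff.1 (isOpen_interior.mem_nhds hy)
    -- An interior point would give a compact closed ball, which by Riesz forces finite dimension.
    -- The dense open complements then meet in a dense set by Baire's theorem.
    exact hF (FiniteDimensional.of_isCompact_closedBall 𝕜 hr
      ((hK n).of_isClosed_subset Metric.isClosed_closedBall (hyr.trans interior_subset)))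
  have := dense_iInter_of_isOpen_nat (fun n => (hK n).isClosed.isOpen_compl) hd
  obtain ⟨e, he, hb⟩ := this.exists_mem_open (Metric.isOpen_ball (x := e₀) (ε := δ))
    ⟨e₀, Metric.mem_ball_self hδ⟩
  exact ⟨e, mem_ball_iff_norm.1 hb, fun n hn => Set.mem_iInter.1 he n hn⟩

namespace QuasiBundle

section Frames

variable {𝕜 : Type u} [RCLike 𝕜] {X : Type w} [TopologicalSpace X]
  {F₁ : Type*} [NormedAddCommGroup F₁] [NormedSpace 𝕜 F₁]
  {F₂ : Type*} [NormedAddCommGroup F₂] [NormedSpace 𝕜 F₂]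
  {A B : QuasiBundle.{u, v, w} 𝕜 X} {L : ∀ x, A.Fib x →ₗ[𝕜] B.Fib x}

/-- The image of a continuous fibrewise injective map from a product bundle of finite rank to a
locally trivial bundle is a vector bundle. -/
theorem isVectorBundle_sub_range (hB : ∀ x, ∃ c : Chart B F₂, x ∈ c.source) {N : ℕ}
    {Ψ : ∀ x, (Fin N → 𝕜) →ₗ[𝕜] B.Fib x}
    (hjc : Continuous fun q : X × (Fin N → 𝕜) => B.pt q.1 (Ψ q.1 q.2))
    (hinj : ∀ x a, Ψ x a = 0 → a = 0) :
    (B.sub fun x => LinearMap.range (Ψ x)).IsVectorBundle := by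
  refine IsVectorBundle.of_charts fun x₀ => ?_
  obtain ⟨c, hx₀⟩ := hB x₀
  let Φ : X → (Fin N → 𝕜) →L[𝕜] F₂ := fun x => LinearMap.toContinuousLinearMap (c.coord x ∘ₗ Ψ x)
  have hΦ : ∀ x ∈ c.source, ContinuousAt Φ x := fun x hx => continuousAt_clm_apply.2 fun a =>
    c.continuousAt_coord (h := fun x => x) (a := fun x => Ψ x a) hx
      (hjc.comp (continuous_id.prodMk continuous_const)).continuousAt
  have hker : LinearMap.ker (Φ x₀ : (Fin N → 𝕜) →ₗ[𝕜] F₂) = ⊥ := by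
    refine LinearMap.ker_eq_bot'.2 fun a ha => hinj x₀ a (c.coord_injective hx₀ ?_)
    rw [map_zero]
    exact ha
  -- A left inverse at `x₀`, from a continuous projection onto the finite-dimensional image. Nearby,
  -- `D ∘ Φ x` stays invertible, and correcting by its inverse `R x` gives left inverses there too.
  obtain ⟨D, hD⟩ : ∃ D : F₂ →L[𝕜] (Fin N → 𝕜), ∀ a, D (Φ x₀ a) = a := by
    obtain ⟨p, hp⟩ := Submodule.ClosedComplemented.of_finiteDimensional
      (LinearMap.range (Φ x₀ : (Fin N → 𝕜) →ₗ[𝕜] F₂))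
    let e := LinearEquiv.ofInjective (Φ x₀ : (Fin N → 𝕜) →ₗ[𝕜] F₂) (LinearMap.ker_eq_bot.1 hker)
    refine ⟨(LinearMap.toContinuousLinearMap (e.symm : _ →ₗ[𝕜] (Fin N → 𝕜))) ∘L p, fun a => ?_⟩
    change e.symm (p (e a : F₂)) = a
    rw [hp, e.symm_apply_apply]
  obtain ⟨R, hR⟩ := ContinuousLinearMap.exists_inverse_near (A := fun x => D ∘L Φ x) (z₀ := x₀)
    (by
      filter_upwards [c.isOpen_source.mem_nhds hx₀] with x hx
      exact continuousAt_const.clm_comp (hΦ x hx)) (ContinuousLinearEquiv.refl 𝕜 _)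
    (by ext1 a; exact (hD a).symm)
  obtain ⟨U, hU, hUo, hxU⟩ := eventually_nhds_iff.1
    (hR.and (c.isOpen_source.mem_nhds hx₀))
  have hRD : ∀ x ∈ U, ∀ a, R x (D (c.coord x (Ψ x a))) = a := fun x hx => (hU x hx).1.2.1
  refine ⟨N, {
    source := U
    isOpen_source := hUo
    coord := fun x => (R x : (Fin N → 𝕜) →ₗ[𝕜] (Fin N → 𝕜)) ∘ₗ (D : F₂ →ₗ[𝕜] (Fin N → 𝕜)) ∘ₗ
      c.coord x ∘ₗ (LinearMap.range (Ψ x)).subtype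
    inv := fun x => (Ψ x).rangeRestrict
    inv_coord := ?_
    coord_inv := ?_
    continuousOn_coord := ?_
    continuousOn_inv := ?_ }, hxU⟩
  · rintro x hx ⟨_, a, rfl⟩
    exact Subtype.ext (congrArg (Ψ x) (hRD x hx a))
  · intro x hx a
    exact hRD x hx a
  · intro p hp
    obtain ⟨⟨hRx, -⟩, hx⟩ := hU p.1 hp
    refine ContinuousAt.continuousWithinAt ?_
    have e0 : ContinuousAt (fun p : (B.sub fun x => LinearMap.range (Ψ x)).Total => p.1) p :=
      (QuasiBundle.continuous_proj _).continuousAt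
    exact (ContinuousAt.comp (f := fun p : (B.sub fun x => LinearMap.range (Ψ x)).Total => p.1)
      hRx e0).clm_apply (D.continuous.continuousAt.comp
        (c.continuousAt_coord (z₀ := p) hx (continuous_sub_val _).continuousAt))
  · exact (continuous_iff_continuousAt.2 fun q =>
      continuousAt_sub_iff.2 hjc.continuousAt).continuousOn

/-- Transversality to a Fredholm morphism is an open condition. -/
theorem IsFredholmFamily.eventually_range_sup_range_eq_top [CompleteSpace F₁] [CompleteSpace F₂]
    (hL : IsFredholmFamily F₁ F₂ L) {Z : Type*} [TopologicalSpace Z] {h : Z → X} {N : ℕ}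
    {Ψ : ∀ z, (Fin N → 𝕜) →ₗ[𝕜] B.Fib (h z)} {z₀ : Z}
    (hΨ : ∀ᶠ z in 𝓝 z₀, ∀ a, ContinuousAt (fun z => B.pt (h z) (Ψ z a)) z)
    (htr : LinearMap.range (L (h z₀)) ⊔ LinearMap.range (Ψ z₀) = ⊤) :
    ∀ᶠ z in 𝓝 z₀, LinearMap.range (L (h z)) ⊔ LinearMap.range (Ψ z) = ⊤ := by
  obtain ⟨c₁, c₂, T, h1, h2, hT, hTL, hker, -⟩ := hL (h z₀)
  -- Continuity of `h` is obtained by projecting the continuous section `Ψ z 0` to the base.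
  have hh : ∀ᶠ z in 𝓝 z₀, ContinuousAt h z := hΨ.mono fun z hz =>
    ContinuousAt.comp (f := fun z => B.pt (h z) (Ψ z 0)) B.continuous_proj.continuousAt (hz 0)
  have hh0 := hh.self_of_nhds
  let Φ : Z → (Fin N → 𝕜) →L[𝕜] F₂ := fun z =>
    LinearMap.toContinuousLinearMap (c₂.coord (h z) ∘ₗ Ψ z)
  have hA : ∀ᶠ z in 𝓝 z₀, ContinuousAt (fun z => (T (h z)).coprod (Φ z)) z := by
    filter_upwards [hh0.eventually hT, hh0 (c₂.isOpen_source.mem_nhds h2), hΨ, hh]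
      with z hTz hz hΨz hhz
    exact ContinuousLinearMap.continuousAt_coprod (ContinuousAt.comp hTz hhz)
      (continuousAt_clm_apply.2 fun a => c₂.continuousAt_coord hz (hΨz a))
  have hs : Function.Surjective ((T (h z₀)).coprod (Φ z₀)) := by
    intro f
    have hf : c₂.inv (h z₀) f ∈ LinearMap.range (L (h z₀)) ⊔ LinearMap.range (Ψ z₀) := by
      rw [htr]; trivial
    obtain ⟨_, ⟨u, rfl⟩, _, ⟨a, rfl⟩, hua⟩ := Submodule.mem_sup.1 hf
    refine ⟨(c₁.coord (h z₀) u, a), ?_⟩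
    rw [ContinuousLinearMap.coprod_apply, hTL.self_of_nhds, c₁.inv_coord _ h1]
    change _ + c₂.coord (h z₀) (Ψ z₀ a) = f
    rw [← map_add, hua, c₂.coord_inv _ h2]
  obtain ⟨m, C, R, hR⟩ := ContinuousLinearMap.exists_inverse_prod_near hA hs
    (ContinuousLinearMap.finite_ker_coprod _ _ hker)
  filter_upwards [hR, hh0.eventually hTL, hh0 (c₂.isOpen_source.mem_nhds h2)]
    with z ⟨_, _, hr⟩ hTz hz
  -- The right inverse part of `R` writes every `b` as a sum of vectors from the two images.
  refine eq_top_iff.2 fun b _ => ?_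
  have h3 := (hr (c₂.coord (h z) b) 0).1
  rw [ContinuousLinearMap.coprod_apply, hTz] at h3
  have h4 : L (h z) (c₁.inv (h z) (R z (c₂.coord (h z) b, 0)).1) +
      Ψ z (R z (c₂.coord (h z) b, 0)).2 = b := by
    refine c₂.coord_injective hz ?_
    rw [map_add]
    exact h3
  rw [← h4]
  exact Submodule.add_mem_sup ⟨_, rfl⟩ ⟨_, rfl⟩

end Frames

end QuasiBundle

namespace QuasiBundle

section Sections

variable {𝕜 : Type u} [RCLike 𝕜] {X : Type w} [TopologicalSpace X]
  {F₂ : Type*} [NormedAddCommGroup F₂] [NormedSpace 𝕜 F₂]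
  {B : QuasiBundle.{u, v, w} 𝕜 X} {ι : Type*} [Fintype ι]

/-- The section of a locally trivial bundle that is glued from constant sections in charts. -/
def gluedSection (c : ι → Chart B F₂) (ρ : ι → X → 𝕜) (x : X) : (ι → F₂) →ₗ[𝕜] B.Fib x :=
  ∑ i, ρ i x • ((c i).inv x ∘ₗ LinearMap.proj i)

theorem gluedSection_apply (c : ι → Chart B F₂) (ρ : ι → X → 𝕜) (x : X) (f : ι → F₂) :
    gluedSection c ρ x f = ∑ i, ρ i x • (c i).inv x (f i) := by
  simp [gluedSection]

/-- The map from the product bundle of rank `N` that is given by `N` glued sections. -/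
def gluedFrame (c : ι → Chart B F₂) (ρ : ι → X → 𝕜) {N : ℕ} (E : Fin N → ι → F₂) (x : X) :
    (Fin N → 𝕜) →ₗ[𝕜] B.Fib x :=
  gluedSection c ρ x ∘ₗ Fintype.linearCombination 𝕜 E

theorem gluedFrame_apply (c : ι → Chart B F₂) (ρ : ι → X → 𝕜) {N : ℕ} (E : Fin N → ι → F₂) (x : X)
    (a : Fin N → 𝕜) : gluedFrame c ρ E x a = gluedSection c ρ x (∑ k, a k • E k) := by
  simp [gluedFrame, Fintype.linearCombination_apply]

theorem gluedFrame_cons (c : ι → Chart B F₂) (ρ : ι → X → 𝕜) {N : ℕ} (f : ι → F₂)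
    (E : Fin N → ι → F₂) (x : X) (a : Fin (N + 1) → 𝕜) :
    gluedFrame c ρ (Fin.cons f E) x a =
      a 0 • gluedSection c ρ x f + gluedFrame c ρ E x (Fin.tail a) := by
  rw [gluedFrame_apply, gluedFrame_apply, Fin.sum_univ_succ, map_add, map_smul]
  rfl

/-- Isolating the contribution of one constant allows it to be chosen with the others fixed. -/
theorem gluedSection_update [DecidableEq ι] (c : ι → Chart B F₂) (ρ : ι → X → 𝕜) (x : X)
    (f : ι → F₂) (j : ι) (e : F₂) :
    gluedSection c ρ x (Function.update f j e) =
      gluedSection c ρ x (Function.update f j 0) + ρ j x • (c j).inv x e := by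
  have h : Function.update f j e = Function.update f j 0 + Pi.single j e := by
    ext i
    by_cases hi : i = j
    · subst hi; simp
    · simp [hi]
  rw [h, map_add]
  congr 1
  rw [gluedSection_apply, Finset.sum_eq_single j]
  · simp
  · intro i _ hi
    simp [hi]
  · simp

theorem continuous_gluedSection (hB : ∀ x, ∃ c : Chart B F₂, x ∈ c.source)
    {c : ι → Chart B F₂} {ρ : ι → X → 𝕜} (hρ : ∀ i, Continuous (ρ i))
    (hs : ∀ i, tsupport (ρ i) ⊆ (c i).source) :
    Continuous fun q : X × (ι → F₂) => B.pt q.1 (gluedSection c ρ q.1 q.2) := by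
  refine continuous_iff_continuousAt.2 fun q => ?_
  obtain ⟨c', hc'⟩ := hB q.1
  simp only [gluedSection_apply]
  exact c'.continuousAt_sum (z₀ := q) (h := fun q : X × (ι → F₂) => q.1) hc' continuousAt_fst
    Finset.univ (a := fun i q => ρ i q.1 • (c i).inv q.1 (q.2 i)) fun i _ =>
      c'.continuousAt_smul_of_tsupport hc' continuousAt_fst (hρ i) fun h =>
        (c i).continuousAt_inv (hs i h) continuousAt_fst (by fun_prop)

/-- The constants `E` also vary with the parameter, because openness of transversality is needed
jointly in `E` and the base point. -/
theorem continuous_gluedFrame (hB : ∀ x, ∃ c : Chart B F₂, x ∈ c.source)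
    {c : ι → Chart B F₂} {ρ : ι → X → 𝕜} (hρ : ∀ i, Continuous (ρ i))
    (hs : ∀ i, tsupport (ρ i) ⊆ (c i).source) {N : ℕ} {Z : Type*} [TopologicalSpace Z] {h : Z → X}
    (hh : Continuous h) {E : Z → Fin N → ι → F₂} (hE : Continuous E) {a : Z → Fin N → 𝕜}
    (ha : Continuous a) : Continuous fun z => B.pt (h z) (gluedFrame c ρ (E z) (h z) (a z)) := by
  simp only [gluedFrame_apply]
  have hsum : Continuous fun z => ∑ k, a z k • E z k := continuous_finsetSum _ fun k _ =>
    Continuous.smul (f := fun z => a z k) (g := fun z => E z k) ((continuous_apply k).comp ha)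
      ((continuous_apply k).comp hE)
  exact (continuous_gluedSection hB hρ hs).comp (hh.prodMk hsum)

variable [CompactSpace X] [CompleteSpace F₂]

/-- In a bundle with infinite-dimensional fibres, a glued section can be perturbed so that it avoids
the image of a given product bundle of finite rank. -/
theorem exists_gluedSection_ne (hF : ¬ FiniteDimensional 𝕜 F₂)
    (hB : ∀ x, ∃ c : Chart B F₂, x ∈ c.source)
    {c : ι → Chart B F₂} {ρ : ι → X → 𝕜} (hρ : ∀ i, Continuous (ρ i))
    (hs : ∀ i, tsupport (ρ i) ⊆ (c i).source) {N : ℕ} {Ψ : ∀ x, (Fin N → 𝕜) →ₗ[𝕜] B.Fib x}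
    (hΨ : Continuous fun q : X × (Fin N → 𝕜) => B.pt q.1 (Ψ q.1 q.2)) (f₀ : ι → F₂) {δ : ℝ}
    (hδ : 0 < δ) :
    ∃ f : ι → F₂, (∀ i, ‖f i - f₀ i‖ < δ) ∧
      ∀ x, (∃ i, ρ i x ≠ 0) → ∀ a, gluedSection c ρ x f ≠ Ψ x a := by
  classical
  -- The constants are altered one index at a time; `S` records the indices whose weight already
  -- guarantees avoidance.
  suffices h : ∀ S : Finset ι, ∃ f : ι → F₂, (∀ i, ‖f i - f₀ i‖ < δ) ∧
      ∀ x, (∃ i ∈ S, ρ i x ≠ 0) → ∀ a, gluedSection c ρ x f ≠ Ψ x a by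
    obtain ⟨f, hf, H⟩ := h Finset.univ
    exact ⟨f, hf, fun x ⟨i, hi⟩ => H x ⟨i, Finset.mem_univ i, hi⟩⟩
  intro S
  induction S using Finset.induction_on with
  | empty => exact ⟨f₀, fun i => by simpa using hδ, fun x ⟨i, hi, _⟩ => by simp at hi⟩
  | insert j S hj ih =>
    obtain ⟨f, hf, H⟩ := ih
    let g := Function.update f j 0
    -- These compact sets exhaust the pairs `(x, a)` with `ρ j x ≠ 0`; the lower bound on the weight
    -- keeps its inverse continuous on each of them.
    let K : ℕ → Set (X × (Fin N → 𝕜)) := fun n =>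
      {x | 1 / ((n : ℝ) + 1) ≤ ‖ρ j x‖} ×ˢ Metric.closedBall 0 n
    -- Where `ρ j x ≠ 0`, `m (x, a)` is the only value of the `j`-th constant for which the section
    -- could equal `Ψ x a` at `x`.
    let m : X × (Fin N → 𝕜) → F₂ := fun q =>
      (ρ j q.1)⁻¹ • ((c j).coord q.1 (Ψ q.1 q.2) - (c j).coord q.1 (gluedSection c ρ q.1 g))
    have hK : ∀ n, IsCompact (K n) := fun n =>
      (isClosed_le continuous_const (hρ j).norm).isCompact.prod (isCompact_closedBall _ _)
    have hne : ∀ n, ∀ q ∈ K n, ρ j q.1 ≠ 0 := fun n q hq h0 => by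
      have h1 : 1 / ((n : ℝ) + 1) ≤ ‖ρ j q.1‖ := hq.1
      rw [h0, norm_zero] at h1
      exact absurd h1 (not_le.2 (by positivity))
    have hm : ∀ n, ContinuousOn m (K n) := fun n q hq => by
      have h0 := hne n q hq
      have hq' : q.1 ∈ (c j).source := hs j (subset_tsupport _ h0)
      refine ContinuousAt.continuousWithinAt ?_
      refine (((hρ j).comp _root_.continuous_fst).continuousAt.inv₀ h0).smul (ContinuousAt.sub ?_ ?_)
      · exact (c j).continuousAt_coord (h := fun q : X × (Fin N → 𝕜) => q.1) hq' hΨ.continuousAt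
      · exact (c j).continuousAt_coord (h := fun q : X × (Fin N → 𝕜) => q.1) hq'
          ((continuous_gluedSection hB hρ hs).comp
            (_root_.continuous_fst.prodMk continuous_const)).continuousAt
    obtain ⟨e, he, hbad⟩ := exists_mem_ball_forall_notMem_of_isCompact 𝕜 hF
      (fun n => (hK n).image_of_continuousOn (hm n)) (f₀ j) hδ
    refine ⟨Function.update f j e, fun i => ?_, fun x hx a hxa => ?_⟩
    · by_cases hi : i = j
      · subst hi; simpa using he
      · simpa [hi] using hf i
    · rw [gluedSection_update] at hxa
      by_cases h0 : ρ j x = 0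
      · obtain ⟨i, hi, hix⟩ := hx
        have hiS : i ∈ S := (Finset.mem_insert.1 hi).resolve_left fun h => hix (h ▸ h0)
        refine H x ⟨i, hiS, hix⟩ a ?_
        -- Where `ρ j` vanishes the section does not see its `j`-th constant, so the induction
        -- hypothesis for `f` applies.
        rw [← hxa, h0, zero_smul, add_zero, ← Function.update_eq_self j f, gluedSection_update, h0,
          zero_smul, add_zero, Function.update_idem]
      · have hx' : x ∈ (c j).source := hs j (subset_tsupport _ h0)
        obtain ⟨n₁, hn₁⟩ := exists_nat_one_div_lt (norm_pos_iff.2 h0)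
        obtain ⟨n₂, hn₂⟩ := exists_nat_ge ‖a‖
        refine hbad (max n₁ n₂) ⟨(x, a), ⟨?_, ?_⟩, ?_⟩
        · refine le_trans ?_ hn₁.le
          have : (n₁ : ℝ) ≤ (max n₁ n₂ : ℕ) := by exact_mod_cast le_max_left _ _
          exact one_div_le_one_div_of_le (by positivity) (by linarith)
        · rw [mem_closedBall_zero_iff]
          exact hn₂.trans (by exact_mod_cast le_max_right _ _)
        · change (ρ j x)⁻¹ • ((c j).coord x (Ψ x a) - (c j).coord x (gluedSection c ρ x g)) = e
          rw [← hxa, map_add, add_sub_cancel_left, map_smul, (c j).coord_inv _ hx', smul_smul,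
            inv_mul_cancel₀ h0, one_smul]

/-- In a bundle with infinite-dimensional fibres, finitely many glued sections can be perturbed so
that they become linearly independent in each fibre. -/
theorem exists_gluedFrame_injective (hF : ¬ FiniteDimensional 𝕜 F₂)
    (hB : ∀ x, ∃ c : Chart B F₂, x ∈ c.source)
    {c : ι → Chart B F₂} {ρ : ι → X → 𝕜} (hρ : ∀ i, Continuous (ρ i))
    (hs : ∀ i, tsupport (ρ i) ⊆ (c i).source) (hne : ∀ x, ∃ i, ρ i x ≠ 0) {N : ℕ}
    (E₀ : Fin N → ι → F₂) {δ : ℝ} (hδ : 0 < δ) :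
    ∃ E : Fin N → ι → F₂, (∀ k i, ‖E k i - E₀ k i‖ < δ) ∧
      ∀ x a, gluedFrame c ρ E x a = 0 → a = 0 := by
  induction N with
  | zero => exact ⟨E₀, fun k => k.elim0, fun x a _ => Subsingleton.elim _ _⟩
  | succ N ih =>
    obtain ⟨E, hE, hinj⟩ := ih (Fin.tail E₀)
    obtain ⟨f, hf, hfa⟩ := exists_gluedSection_ne hF hB hρ hs (Ψ := gluedFrame c ρ E)
      (continuous_gluedFrame hB hρ hs _root_.continuous_fst continuous_const continuous_snd) (E₀ 0) hδ
    refine ⟨Fin.cons f E, fun k => Fin.cases hf hE k, fun x a ha => ?_⟩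
    rw [gluedFrame_cons] at ha
    have h0 : a 0 = 0 := by
      by_contra h0
      -- A nonzero leading coefficient could be divided out, placing the new section in the span of
      -- the previous ones.
      refine hfa x (hne x) ((a 0)⁻¹ • (-1 : 𝕜) • Fin.tail a) ?_
      rw [map_smul, map_smul, ← eq_neg_one_smul_of_add_eq_zero ha, smul_smul, inv_mul_cancel₀ h0,
        one_smul]
    rw [h0, zero_smul, zero_add] at ha
    rw [← Fin.cons_self_tail a, h0, hinj x _ ha]
    ext k
    exact Fin.cases rfl (fun _ => rfl) k

end Sections

section Existence

variable {𝕜 : Type u} [RCLike 𝕜] {X : Type w} [TopologicalSpace X]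
  {F₁ : Type*} [NormedAddCommGroup F₁] [NormedSpace 𝕜 F₁] [CompleteSpace F₁]
  {F₂ : Type*} [NormedAddCommGroup F₂] [NormedSpace 𝕜 F₂] [CompleteSpace F₂]
  {A B : QuasiBundle.{u, v, w} 𝕜 X} {L : ∀ x, A.Fib x →ₗ[𝕜] B.Fib x}

/-- Near each point, finitely many sections that are constant in a chart span a complement of the
image of a Fredholm morphism. -/
theorem IsFredholmFamily.exists_local_transversal (hL : IsFredholmFamily F₁ F₂ L) (x₀ : X) :
    ∃ (c : Chart B F₂) (n : ℕ) (e : Fin n → F₂) (U : Set X), IsOpen U ∧ x₀ ∈ U ∧ U ⊆ c.source ∧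
      ∀ x ∈ U, LinearMap.range (L x) ⊔
        LinearMap.range (c.inv x ∘ₗ Fintype.linearCombination 𝕜 e) = ⊤ := by
  obtain ⟨c₁, c, T, h1, h2, hT, hTL, hker, W, hW, hTW⟩ := hL x₀
  obtain ⟨n, e, he⟩ := Submodule.fg_iff_exists_fin_generating_family.1
    (Module.Finite.iff_fg.1 hW)
  have hΨ : ∀ᶠ x in 𝓝 x₀, ∀ a, ContinuousAt
      (fun x => B.pt x ((c.inv x ∘ₗ Fintype.linearCombination 𝕜 e) a)) x := by
    filter_upwards [c.isOpen_source.mem_nhds h2] with x hx a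
    exact c.continuousAt_inv (h := fun x => x) (a := fun _ => Fintype.linearCombination 𝕜 e a) hx
      continuousAt_id continuousAt_const
  have htr : LinearMap.range (L x₀) ⊔
      LinearMap.range (c.inv x₀ ∘ₗ Fintype.linearCombination 𝕜 e) = ⊤ := by
    refine eq_top_iff.2 fun b _ => ?_
    have hb : c.coord x₀ b ∈ (T x₀).range ⊔ W := by rw [hTW]; trivial
    obtain ⟨_, ⟨u, rfl⟩, w, hw, huw⟩ := Submodule.mem_sup.1 hb
    rw [← he, ← Fintype.range_linearCombination] at hw
    obtain ⟨a, rfl⟩ := hw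
    have h3 : L x₀ (c₁.inv x₀ u) + c.inv x₀ (Fintype.linearCombination 𝕜 e a) = b := by
      refine c.coord_injective h2 ?_
      rw [map_add, c.coord_inv _ h2, ← huw]
      congr 1
      exact (hTL.self_of_nhds u).symm
    rw [← h3]
    exact Submodule.add_mem_sup ⟨_, rfl⟩ ⟨a, rfl⟩
  obtain ⟨U, hU, hUo, hxU⟩ := eventually_nhds_iff.1
    ((hL.eventually_range_sup_range_eq_top (h := fun x => x) hΨ htr).and
      (c.isOpen_source.mem_nhds h2))
  exact ⟨c, n, e, U, hUo, hxU, fun x hx => (hU x hx).2, fun x hx => (hU x hx).1⟩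

/-- For each Fredholm morphism there is a transversal finite-dimensional subbundle of the target. -/
theorem IsFredholmFamily.exists_transversal [CompactSpace X] [T2Space X]
    (hL : IsFredholmFamily F₁ F₂ L) :
    ∃ V : ∀ x, Submodule 𝕜 (B.Fib x), (B.sub V).IsVectorBundle ∧
      ∀ x, LinearMap.range (L x) ⊔ V x = ⊤ := by
  have hB : ∀ x, ∃ c : Chart B F₂, x ∈ c.source := fun x => by
    obtain ⟨-, c, -, -, hc, -⟩ := hL x
    exact ⟨c, hc⟩
  by_cases hF : FiniteDimensional 𝕜 F₂
  -- With finite-dimensional fibres the whole target is a transversal subbundle; the perturbation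
  -- argument below needs infinite dimension.
  · refine ⟨fun _ => ⊤, ?_, fun x => sup_top_eq _⟩
    refine IsVectorBundle.of_iso (R := B) ⟨fun x => Submodule.topEquiv, continuous_sub_val _,
      continuous_iff_continuousAt.2 fun p => continuousAt_sub_iff.2 continuousAt_id⟩ ?_
    refine IsVectorBundle.of_charts fun x => ?_
    obtain ⟨c, hc⟩ := hB x
    exact ⟨Module.finrank 𝕜 F₂, c.congr (ContinuousLinearEquiv.ofFinrankEq (by simp)), hc⟩
  choose c n e U hUo hxU hUc hUL using hL.exists_local_transversal
  obtain ⟨t, ρ, hρ, hsupp, hsum⟩ := exists_finite_partition 𝕜 U hUo hxU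
  have hs : ∀ i : t, tsupport (ρ i) ⊆ (c i).source := fun i => (hsupp i).trans (hUc i)
  have hne : ∀ x, ∃ i, ρ i x ≠ 0 := fun x => by
    by_contra! h
    have := hsum x
    simp [h] at this
  classical
  let σ := (Fintype.equivFin (Σ i : t, Fin (n i))).symm
  -- Each local spanning vector contributes one global section, which uses only its own chart and
  -- weight.
  let E₀ : Fin (Fintype.card (Σ i : t, Fin (n i))) → t → F₂ := fun k =>
    Pi.single (σ k).1 (e (σ k).1 (σ k).2)
  have hE₀ : ∀ x, LinearMap.range (L x) ⊔
      LinearMap.range (gluedFrame (fun i : t => c i) ρ E₀ x) = ⊤ := by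
    intro x
    obtain ⟨i, hi⟩ := hne x
    refine top_le_iff.1 ((hUL i x (hsupp i (subset_tsupport _ hi))).ge.trans
      (sup_le_sup_left ?_ _))
    rw [LinearMap.range_comp, Fintype.range_linearCombination, Submodule.map_span_le]
    rintro _ ⟨k, rfl⟩
    -- Dividing by the nonzero weight recovers the local section at `x`, so the glued ones span at
    -- least as much.
    refine ⟨(ρ i x)⁻¹ • Pi.single (σ.symm ⟨i, k⟩) 1, ?_⟩
    have hk : E₀ (σ.symm ⟨i, k⟩) = Pi.single i (e i k) :=
      congrArg (fun p : (Σ i : t, Fin (n i)) => (Pi.single p.1 (e p.1 p.2) : t → F₂))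
        (σ.apply_symm_apply ⟨i, k⟩)
    rw [map_smul, gluedFrame_apply, Finset.sum_eq_single (σ.symm ⟨i, k⟩) (fun l _ hl => by simp [hl])
      (by simp), Pi.single_eq_same, one_smul, gluedSection_apply, hk,
      Finset.sum_eq_single i (fun l _ hl => by simp [hl]) (by simp), Pi.single_eq_same, smul_smul,
      inv_mul_cancel₀ hi, one_smul]
  have hopen : ∀ x ∈ (Set.univ : Set X), ∀ᶠ p : (Fin (Fintype.card (Σ i : t, Fin (n i))) → t → F₂) × X
      in 𝓝 (E₀, x), LinearMap.range (L p.2) ⊔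
        LinearMap.range (gluedFrame (fun i : t => c i) ρ p.1 p.2) = ⊤ := fun x _ =>
    hL.eventually_range_sup_range_eq_top
      (h := fun p : (Fin (Fintype.card (Σ i : t, Fin (n i))) → t → F₂) × X => p.2)
      (Ψ := fun p => gluedFrame (fun i : t => c i) ρ p.1 p.2)
      (Filter.Eventually.of_forall fun p a => (continuous_gluedFrame hB hρ hs continuous_snd
        _root_.continuous_fst continuous_const).continuousAt) (hE₀ x)
  -- Compactness of `X` turns openness in `(E, x)` into a single tolerance `δ` for the perturbation.
  obtain ⟨δ, hδ, hball⟩ := Metric.eventually_nhds_iff.1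
    (isCompact_univ.eventually_forall_of_forall_eventually
      (P := fun E x => LinearMap.range (L x) ⊔
        LinearMap.range (gluedFrame (fun i : t => c i) ρ E x) = ⊤) hopen)
  obtain ⟨E, hE, hinj⟩ := exists_gluedFrame_injective hF hB hρ hs hne E₀ hδ
  refine ⟨fun x => LinearMap.range (gluedFrame (fun i : t => c i) ρ E x), ?_, fun x => ?_⟩
  · exact isVectorBundle_sub_range hB
      (continuous_gluedFrame hB hρ hs _root_.continuous_fst continuous_const continuous_snd) hinj
  · refine hball ?_ x (Set.mem_univ x)
    refine (dist_pi_lt_iff hδ).2 fun k => (dist_pi_lt_iff hδ).2 fun i => ?_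
    rw [dist_eq_norm]
    exact hE k i

end Existence

end QuasiBundle

/-! ### Comparison with Banach bundles and pullbacks -/

namespace QuasiBundle

section OfBundle

variable {𝕜 : Type u} [RCLike 𝕜] {X : Type w} [TopologicalSpace X]

/-- The quasi-vector bundle underlying a Banach bundle. -/
abbrev ofBundle (𝕜 : Type u) [RCLike 𝕜] {X : Type w} [TopologicalSpace X]
    (F : Type*) [TopologicalSpace F] (E : X → Type v)
    [∀ x, AddCommMonoid (E x)] [∀ x, Module 𝕜 (E x)] [TopologicalSpace (TotalSpace F E)]
    [∀ x, TopologicalSpace (E x)] [FiberBundle F E] : QuasiBundle.{u, v, w} 𝕜 X where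
  Fib := E
  top := TopologicalSpace.induced (fun p => (⟨p.1, p.2⟩ : TotalSpace F E)) inferInstance
  continuous_fst :=
    continuous_comp_induced
      (fun p : (Σ x, E x) => (⟨p.1, p.2⟩ : TotalSpace F E)) (FiberBundle.continuous_proj F E)

theorem isInducing_ofBundle (F : Type*) [TopologicalSpace F] (E : X → Type v)
    [∀ x, AddCommMonoid (E x)] [∀ x, Module 𝕜 (E x)] [TopologicalSpace (TotalSpace F E)]
    [∀ x, TopologicalSpace (E x)] [FiberBundle F E] :
    IsInducing (fun p : (ofBundle 𝕜 F E).Total => (⟨p.1, p.2⟩ : TotalSpace F E)) := ⟨rfl⟩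

theorem isInducing_ofSubmodule (F : Type*) [TopologicalSpace F] (E : X → Type v)
    [∀ x, AddCommMonoid (E x)] [∀ x, Module 𝕜 (E x)] [TopologicalSpace (TotalSpace F E)]
    [∀ x, TopologicalSpace (E x)] [FiberBundle F E] (S : ∀ x, Submodule 𝕜 (E x)) :
    IsInducing (fun p : (ofSubmodule 𝕜 F E S).Total => (⟨p.1, p.2⟩ : TotalSpace F E)) := ⟨rfl⟩

theorem isInducing_sub (Q : QuasiBundle.{u, v, w} 𝕜 X) (S : ∀ x, Submodule 𝕜 (Q.Fib x)) :
    IsInducing (fun p : (Q.sub S).Total => Q.pt p.1 (p.2 : Q.Fib p.1)) := ⟨rfl⟩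

theorem isInducing_pullback {Y : Type u'} [TopologicalSpace Y] (f : Y → X)
    (Q : QuasiBundle.{u, v, w} 𝕜 X) :
    IsInducing (fun p : (Q.pullback f).Total => ((p.1, Q.pt (f p.1) p.2) : Y × Q.Total)) := ⟨rfl⟩

/-- A subbundle of a Banach bundle is a subbundle of the underlying quasi-vector bundle. -/
def ofSubmoduleIso (F : Type*) [TopologicalSpace F] (E : X → Type v)
    [∀ x, AddCommMonoid (E x)] [∀ x, Module 𝕜 (E x)] [TopologicalSpace (TotalSpace F E)]
    [∀ x, TopologicalSpace (E x)] [FiberBundle F E] (S : ∀ x, Submodule 𝕜 (E x)) :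
    Iso (ofSubmodule 𝕜 F E S) ((ofBundle 𝕜 F E).sub S) where
  equiv x := LinearEquiv.refl 𝕜 (S x)
  continuous_equiv := (isInducing_sub _ _).continuous_iff.2
    ((isInducing_ofBundle F E).continuous_iff.2 (isInducing_ofSubmodule F E S).continuous)
  continuous_symm := (isInducing_ofSubmodule F E S).continuous_iff.2
    (((isInducing_ofBundle F E).comp (isInducing_sub _ _)).continuous)

/-- A subbundle of a pullback of a Banach bundle is a subbundle of the pullback of the underlying
quasi-vector bundle. -/
def ofSubmodulePullbackIso (F : Type*) [TopologicalSpace F] (E : X → Type v)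
    [∀ x, AddCommMonoid (E x)] [∀ x, Module 𝕜 (E x)] [TopologicalSpace (TotalSpace F E)]
    [∀ x, TopologicalSpace (E x)] [FiberBundle F E] {Y : Type u'} [TopologicalSpace Y] (f : C(Y, X))
    (S : ∀ y, Submodule 𝕜 (((f : Y → X) *ᵖ E) y)) :
    Iso (ofSubmodule 𝕜 F ((f : Y → X) *ᵖ E) S) (((ofBundle 𝕜 F E).pullback f).sub S) where
  equiv x := LinearEquiv.refl 𝕜 (S x)
  continuous_equiv := (isInducing_sub _ _).continuous_iff.2
    ((isInducing_pullback _ _).continuous_iff.2 (((continuous_proj _).prodMk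
      ((isInducing_ofBundle F E).continuous_iff.2 ((Pullback.continuous_lift F E f).comp
        (isInducing_ofSubmodule F ((f : Y → X) *ᵖ E) S).continuous)))))
  continuous_symm := (isInducing_ofSubmodule F ((f : Y → X) *ᵖ E) S).continuous_iff.2
    ((inducing_pullbackTotalSpaceEmbedding F E f).continuous_iff.2
      ((continuous_proj _).prodMk ((isInducing_ofBundle F E).continuous.comp
        ((continuous_pullback_lift f (ofBundle 𝕜 F E)).comp (continuous_sub_val _)))))

/-- The pullback of a subbundle is a subbundle of the pullback. -/
def subPullbackIso (Q : QuasiBundle.{u, v, w} 𝕜 X) (S : ∀ x, Submodule 𝕜 (Q.Fib x))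
    {Y : Type u'} [TopologicalSpace Y] (f : Y → X) :
    Iso ((Q.sub S).pullback f) ((Q.pullback f).sub fun y => S (f y)) where
  equiv y := LinearEquiv.refl 𝕜 (S (f y))
  continuous_equiv := (isInducing_sub _ _).continuous_iff.2
    (continuous_pullback_iff.2 ⟨continuous_proj _,
      (continuous_sub_val _).comp (continuous_pullback_lift f _)⟩)
  continuous_symm := continuous_pullback_iff.2 ⟨continuous_proj _,
    (isInducing_sub _ _).continuous_iff.2
      ((continuous_pullback_lift f Q).comp (continuous_sub_val _))⟩

/-- The chart of the underlying quasi-vector bundle that is given by a local trivialisation. -/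
noncomputable def Chart.ofTrivialization {F : Type*} [NormedAddCommGroup F] [NormedSpace 𝕜 F]
    {E : X → Type v}
    [∀ x, AddCommMonoid (E x)] [∀ x, Module 𝕜 (E x)] [TopologicalSpace (TotalSpace F E)]
    [∀ x, TopologicalSpace (E x)] [FiberBundle F E]
    (e : Trivialization F (π F E)) [e.IsLinear 𝕜] : Chart (ofBundle 𝕜 F E) F where
  source := e.baseSet
  isOpen_source := e.open_baseSet
  coord x := e.linearMapAt 𝕜 x
  inv x := e.symmₗ 𝕜 x
  inv_coord x hx a := e.symmₗ_linearMapAt hx a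
  coord_inv x hx a := e.linearMapAt_symmₗ hx a
  continuousOn_coord := by
    have h : ContinuousOn (fun p : (ofBundle 𝕜 F E).Total => (e ⟨p.1, p.2⟩).2)
        (proj ⁻¹' e.baseSet) :=
      _root_.continuous_snd.comp_continuousOn (e.continuousOn.comp
        (isInducing_ofBundle F E).continuous.continuousOn fun p hp => e.mem_source.2 hp)
    refine h.congr fun p hp => ?_
    exact congrFun (e.coe_linearMapAt_of_mem hp) p.2
  continuousOn_inv := by
    refine (isInducing_ofBundle F E).continuousOn_iff.2 (e.continuousOn_symm.congr fun q hq => ?_)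
    exact congrArg (TotalSpace.mk' F q.1) (congrFun (e.coe_symmₗ (R := 𝕜) hq.1) q.2)

/-- A Fredholm morphism of Banach bundles is a Fredholm family on the underlying quasi-vector
bundles. -/
theorem isFredholmFamily_of_isFredholmMorphism
    (F₁ : Type*) [NormedAddCommGroup F₁] [NormedSpace 𝕜 F₁]
    (F₂ : Type*) [NormedAddCommGroup F₂] [NormedSpace 𝕜 F₂]
    {E₁ : X → Type v} [∀ x, AddCommGroup (E₁ x)] [∀ x, Module 𝕜 (E₁ x)]
    [TopologicalSpace (TotalSpace F₁ E₁)] [∀ x, TopologicalSpace (E₁ x)]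
    [FiberBundle F₁ E₁] [VectorBundle 𝕜 F₁ E₁]
    {E₂ : X → Type v} [∀ x, AddCommGroup (E₂ x)] [∀ x, Module 𝕜 (E₂ x)]
    [TopologicalSpace (TotalSpace F₂ E₂)] [∀ x, TopologicalSpace (E₂ x)]
    [FiberBundle F₂ E₂] [VectorBundle 𝕜 F₂ E₂]
    [∀ x, IsTopologicalAddGroup (E₂ x)] [∀ x, ContinuousSMul 𝕜 (E₂ x)]
    (L : ∀ x, E₁ x →L[𝕜] E₂ x) (hL : IsFredholmMorphism F₁ F₂ L) :
    IsFredholmFamily F₁ F₂ (A := ofBundle 𝕜 F₁ E₁) (B := ofBundle 𝕜 F₂ E₂)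
      (fun x => (L x : E₁ x →ₗ[𝕜] E₂ x)) := by
  intro x₀
  let e₁ := trivializationAt F₁ E₁ x₀
  let e₂ := trivializationAt F₂ E₂ x₀
  let e := trivializationAt (F₁ →L[𝕜] F₂) (fun x => E₁ x →L[𝕜] E₂ x) x₀
  have h1 : x₀ ∈ e₁.baseSet := FiberBundle.mem_baseSet_trivializationAt' x₀
  have h2 : x₀ ∈ e₂.baseSet := FiberBundle.mem_baseSet_trivializationAt' x₀
  let T : X → F₁ →L[𝕜] F₂ := fun x => (e ⟨x, L x⟩).2
  -- The trivialisation of the bundle of operators is by definition conjugation by those of `E₁` and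
  -- `E₂`.
  have hT : ∀ x u, T x u = e₂.linearMapAt 𝕜 x (L x (e₁.symmₗ 𝕜 x u)) := fun x u => rfl
  refine ⟨Chart.ofTrivialization e₁, Chart.ofTrivialization e₂, T, h1, h2, ?_,
    Filter.Eventually.of_forall hT, ?_, ?_⟩
  · filter_upwards [(e₁.open_baseSet.inter e₂.open_baseSet).mem_nhds ⟨h1, h2⟩] with x hx
    have hx' : (⟨x, L x⟩ : TotalSpace (F₁ →L[𝕜] F₂) (fun x => E₁ x →L[𝕜] E₂ x)) ∈ e.source :=
      e.mem_source.2 hx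
    exact (ContinuousAt.comp
      (f := fun x => (⟨x, L x⟩ : TotalSpace (F₁ →L[𝕜] F₂) (fun x => E₁ x →L[𝕜] E₂ x)))
      (e.continuousOn.continuousAt (e.open_source.mem_nhds hx'))
      hL.1.continuousAt).snd
  · have := (hL.2 x₀).finite_ker
    let g : (T x₀).ker →ₗ[𝕜] (L x₀).ker := LinearMap.codRestrict _
      (e₁.symmₗ 𝕜 x₀ ∘ₗ (T x₀).ker.subtype) fun u => by
        have hu : e₂.linearMapAt 𝕜 x₀ (L x₀ (e₁.symmₗ 𝕜 x₀ u)) = 0 := u.2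
        have h3 := e₂.symmₗ_linearMapAt (R := 𝕜) h2 (L x₀ (e₁.symmₗ 𝕜 x₀ u))
        rw [hu, map_zero] at h3
        exact h3.symm
    refine Module.Finite.of_injective g fun a b hab => Subtype.ext ?_
    have h4 : e₁.symmₗ 𝕜 x₀ a = e₁.symmₗ 𝕜 x₀ b := congrArg Subtype.val hab
    rw [← e₁.linearMapAt_symmₗ (R := 𝕜) h1 (a : F₁), h4, e₁.linearMapAt_symmₗ h1]
  -- An algebraic complement of the image has finite dimension because the cokernel does; the chart
  -- carries it into `F₂`.
  · obtain ⟨W, hW⟩ := Submodule.exists_isCompl (L x₀).range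
    have hfg := Submodule.CoFG.fg_of_isCompl hW (hL.2 x₀).finite_coker
    refine ⟨W.map (e₂.linearMapAt 𝕜 x₀), Module.Finite.iff_fg.2 (hfg.map _),
      eq_top_iff.2 fun f _ => ?_⟩
    have hf : e₂.symmₗ 𝕜 x₀ f ∈ (L x₀).range ⊔ W := by rw [hW.sup_eq_top]; trivial
    obtain ⟨_, ⟨u, rfl⟩, y, hy, huy⟩ := Submodule.mem_sup.1 hf
    rw [← e₂.linearMapAt_symmₗ (R := 𝕜) h2 f, ← huy, map_add]
    refine Submodule.add_mem_sup ⟨e₁.linearMapAt 𝕜 x₀ u, ?_⟩ ⟨y, hy, rfl⟩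
    change T x₀ _ = _
    rw [hT, e₁.symmₗ_linearMapAt h1]
    rfl

/-- The operators representing the pullback at `y` are those at `f y` in the pulled back charts, so
the finiteness conditions are unchanged. -/
theorem IsFredholmFamily.pullback {F₁ : Type*} [NormedAddCommGroup F₁] [NormedSpace 𝕜 F₁]
    {F₂ : Type*} [NormedAddCommGroup F₂] [NormedSpace 𝕜 F₂] {A B : QuasiBundle.{u, v, w} 𝕜 X}
    {L : ∀ x, A.Fib x →ₗ[𝕜] B.Fib x} (hL : IsFredholmFamily F₁ F₂ L) {Y : Type u'}
    [TopologicalSpace Y] {f : Y → X} (hf : Continuous f) :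
    IsFredholmFamily F₁ F₂ (A := A.pullback f) (B := B.pullback f) (fun y => L (f y)) := by
  intro y₀
  obtain ⟨c₁, c₂, T, h1, h2, hT, hTL, hker, hW⟩ := hL (f y₀)
  obtain ⟨d₁, hs₁, hc₁, hi₁⟩ := c₁.exists_pullback hf
  obtain ⟨d₂, hs₂, hc₂, hi₂⟩ := c₂.exists_pullback hf
  refine ⟨d₁, d₂, fun y => T (f y), hs₁ ▸ h1, hs₂ ▸ h2, ?_, ?_, hker, hW⟩
  · filter_upwards [hf.continuousAt.eventually hT] with y hy
    exact ContinuousAt.comp hy hf.continuousAt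
  · filter_upwards [hf.continuousAt.eventually hTL] with y hy u
    rw [hy, hc₂, hi₁]

end OfBundle

end QuasiBundle

/-! ### Classes in K-theory and the index of a family -/

namespace KGroup

variable {𝕜 : Type u} [RCLike 𝕜] {X : Type w} [TopologicalSpace X]

theorem mk_eq_of_iso {Q R : QuasiBundle.{u, v, w} 𝕜 X} (e : QuasiBundle.Iso Q R)
    (hQ : Q.IsVectorBundle) (hR : R.IsVectorBundle) : mk Q hQ = mk R hR :=
  congrArg Algebra.GrothendieckAddGroup.of
    (Quotient.sound ⟨e⟩ : VectClass.mk Q hQ = VectClass.mk R hR)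

theorem mk_add_mk {Q R : QuasiBundle.{u, v, w} 𝕜 X}
    (hQ : Q.IsVectorBundle) (hR : R.IsVectorBundle) :
    mk Q hQ + mk R hR = mk (Q.sum R) (hQ.sum hR) :=
  (map_add Algebra.GrothendieckAddGroup.of (VectClass.mk Q hQ) (VectClass.mk R hR)).symm

theorem pullback_mk {Y : Type u'} [TopologicalSpace Y] (f : C(Y, X))
    {Q : QuasiBundle.{u, v, w} 𝕜 X} (hQ : Q.IsVectorBundle) :
    pullback f (mk Q hQ) = mk (Q.pullback f) (hQ.pullback f.continuous) :=
  DFunLike.congr_fun (Algebra.GrothendieckAddGroup.lift.symm_apply_apply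
    (Algebra.GrothendieckAddGroup.of.comp (VectClass.pullback f))) (VectClass.mk Q hQ)

theorem pullback_mk_eq_of_homotopic [CompactSpace X] [T2Space X] {Y : Type u'} [TopologicalSpace Y]
    [CompactSpace Y] {f g : C(Y, X)} (h : f.Homotopic g) {Q : QuasiBundle.{u, v, w} 𝕜 X}
    (hQ : Q.IsVectorBundle) : pullback f (mk Q hQ) = pullback g (mk Q hQ) := by
  obtain ⟨e⟩ := hQ.nonempty_iso_of_homotopic h
  rw [pullback_mk, pullback_mk]
  exact mk_eq_of_iso e _ _

end KGroup

namespace QuasiBundle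

section Index

variable {𝕜 : Type u} [RCLike 𝕜] {X : Type w} [TopologicalSpace X]
  {A B : QuasiBundle.{u, v, w} 𝕜 X}

/-- `κ` is of the form `[L⁻¹ V] - [V]` for some subbundle `V` that is transversal to `L`. -/
def IsFamilyIndex (L : ∀ x, A.Fib x →ₗ[𝕜] B.Fib x) (κ : KGroup.{u, v, w} 𝕜 X) : Prop :=
  ∃ (V : ∀ x, Submodule 𝕜 (B.Fib x)) (hV : (B.sub V).IsVectorBundle)
    (hE : (A.sub fun x => (V x).comap (L x)).IsVectorBundle),
    (∀ x, LinearMap.range (L x) ⊔ V x = ⊤) ∧ κ = KGroup.mk _ hE - KGroup.mk _ hV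

variable {L : ∀ x, A.Fib x →ₗ[𝕜] B.Fib x} {κ : KGroup.{u, v, w} 𝕜 X}

/-- Transversality and preimages are fibrewise, so the pullback of `V` is transversal and the
pullback of `E(L, V)` is its preimage. -/
theorem IsFamilyIndex.pullback (h : IsFamilyIndex L κ) {Y : Type u'} [TopologicalSpace Y]
    (f : C(Y, X)) : IsFamilyIndex (A := A.pullback f) (B := B.pullback f) (fun y => L (f y))
      (KGroup.pullback f κ) := by
  obtain ⟨V, hV, hE, htr, rfl⟩ := h
  have eV := subPullbackIso B V f
  have eE := subPullbackIso A (fun x => (V x).comap (L x)) f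
  refine ⟨fun y => V (f y), .of_iso eV.symm (hV.pullback f.continuous),
    .of_iso eE.symm (hE.pullback f.continuous), fun y => htr (f y), ?_⟩
  rw [map_sub, KGroup.pullback_mk, KGroup.pullback_mk]
  exact congrArg₂ _ (KGroup.mk_eq_of_iso eE _ _) (KGroup.mk_eq_of_iso eV _ _)

theorem IsFamilyIndex.pullback_eq_of_homotopic [CompactSpace X] [T2Space X]
    (h : IsFamilyIndex L κ) {Y : Type u'} [TopologicalSpace Y] [CompactSpace Y] {f g : C(Y, X)}
    (hfg : f.Homotopic g) : KGroup.pullback f κ = KGroup.pullback g κ := by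
  obtain ⟨V, hV, hE, htr, rfl⟩ := h
  rw [map_sub, map_sub, KGroup.pullback_mk_eq_of_homotopic hfg hE,
    KGroup.pullback_mk_eq_of_homotopic hfg hV]

variable {F₁ : Type*} [NormedAddCommGroup F₁] [NormedSpace 𝕜 F₁] [CompleteSpace F₁]
  {F₂ : Type*} [NormedAddCommGroup F₂] [NormedSpace 𝕜 F₂] [CompleteSpace F₂]
  [CompactSpace X] [T2Space X]

theorem IsFredholmFamily.exists_isFamilyIndex (hL : IsFredholmFamily F₁ F₂ L) :
    ∃ κ, IsFamilyIndex L κ := by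
  obtain ⟨V, hV, htr⟩ := hL.exists_transversal
  exact ⟨_, V, hV, hL.isVectorBundle_comap hV htr, htr, rfl⟩

/-- In K-theory the exchange isomorphism reads `[E(L, V)] + [V'] = [E(L, V')] + [V]`. -/
theorem IsFredholmFamily.eq_of_isFamilyIndex (hL : IsFredholmFamily F₁ F₂ L)
    {κ' : KGroup.{u, v, w} 𝕜 X} (h : IsFamilyIndex L κ) (h' : IsFamilyIndex L κ') : κ = κ' := by
  obtain ⟨V, hV, hE, htr, rfl⟩ := h
  obtain ⟨V', hV', hE', htr', rfl⟩ := h'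
  obtain ⟨e⟩ := hL.nonempty_iso_exchange hV htr hV' htr'
  rw [sub_eq_sub_iff_add_eq_add, KGroup.mk_add_mk, KGroup.mk_add_mk]
  exact KGroup.mk_eq_of_iso e _ _

end Index

end QuasiBundle

/-! ### The index bundle -/

section IndexClass

open QuasiBundle

variable {𝕜 : Type u} [RCLike 𝕜] {X : Type w} [TopologicalSpace X]
  (F₁ : Type*) [NormedAddCommGroup F₁]
  (F₂ : Type*) [NormedAddCommGroup F₂]
  {E₁ : X → Type v} {E₂ : X → Type v}
  [∀ x, AddCommMonoid (E₁ x)] [∀ x, Module 𝕜 (E₁ x)] [TopologicalSpace (TotalSpace F₁ E₁)]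
  [∀ x, TopologicalSpace (E₁ x)] [FiberBundle F₁ E₁]
  [∀ x, AddCommMonoid (E₂ x)] [∀ x, Module 𝕜 (E₂ x)] [TopologicalSpace (TotalSpace F₂ E₂)]
  [∀ x, TopologicalSpace (E₂ x)] [FiberBundle F₂ E₂]

/-- The same subspaces serve on both sides; only the constructions of the total space topology
differ, and the identity on fibres is an isomorphism between them. -/
theorem isIndexClass_iff (L : ∀ x, E₁ x →L[𝕜] E₂ x) (κ : KGroup.{u, v, w} 𝕜 X) :
    IsIndexClass F₁ F₂ L κ ↔ IsFamilyIndex (A := ofBundle 𝕜 F₁ E₁) (B := ofBundle 𝕜 F₂ E₂)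
      (fun x => (L x : E₁ x →ₗ[𝕜] E₂ x)) κ := by
  have eV := fun V => ofSubmoduleIso (𝕜 := 𝕜) F₂ E₂ V
  have eE := fun V => ofSubmoduleIso (𝕜 := 𝕜) F₁ E₁ V
  constructor
  · rintro ⟨V, hV, hE, htr, rfl⟩
    exact ⟨V, .of_iso (eV _).symm hV, .of_iso (eE _).symm hE, htr,
      congrArg₂ _ (KGroup.mk_eq_of_iso (eE _) _ _) (KGroup.mk_eq_of_iso (eV _) _ _)⟩
  · rintro ⟨V, hV, hE, htr, rfl⟩
    exact ⟨V, .of_iso (eV _) hV, .of_iso (eE _) hE, htr,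
      congrArg₂ _ (KGroup.mk_eq_of_iso (eE _).symm _ _) (KGroup.mk_eq_of_iso (eV _).symm _ _)⟩

/-- This moves the pulled back Banach bundles to pullbacks of quasi-vector bundles, where the
Fredholm property of `f^* L` follows directly from that of `L`. -/
theorem isIndexClass_pullbackMorphism_iff {Y : Type u'} [TopologicalSpace Y] (f : C(Y, X))
    (L : ∀ x, E₁ x →L[𝕜] E₂ x) (κ : KGroup.{u, v, u'} 𝕜 Y) :
    IsIndexClass F₁ F₂ (pullbackMorphism f L) κ ↔
      IsFamilyIndex (A := (ofBundle 𝕜 F₁ E₁).pullback f) (B := (ofBundle 𝕜 F₂ E₂).pullback f)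
        (fun y => (L (f y) : E₁ (f y) →ₗ[𝕜] E₂ (f y))) κ := by
  have eV := fun V => ofSubmodulePullbackIso (𝕜 := 𝕜) F₂ E₂ f V
  have eE := fun V => ofSubmodulePullbackIso (𝕜 := 𝕜) F₁ E₁ f V
  constructor
  · rintro ⟨V, hV, hE, htr, rfl⟩
    exact ⟨V, .of_iso (eV _).symm hV, .of_iso (eE _).symm hE, htr,
      congrArg₂ _ (KGroup.mk_eq_of_iso (eE _) _ _) (KGroup.mk_eq_of_iso (eV _) _ _)⟩
  · rintro ⟨V, hV, hE, htr, rfl⟩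
    exact ⟨V, .of_iso (eV _) hV, .of_iso (eE _) hE, htr,
      congrArg₂ _ (KGroup.mk_eq_of_iso (eE _).symm _ _) (KGroup.mk_eq_of_iso (eV _).symm _ _)⟩

theorem indexBundle_eq {L : ∀ x, E₁ x →L[𝕜] E₂ x} {κ : KGroup.{u, v, w} 𝕜 X}
    (h : IsIndexClass F₁ F₂ L κ) (hu : ∀ κ', IsIndexClass F₁ F₂ L κ' → κ' = κ) :
    indexBundle F₁ F₂ L = κ := by
  have hex : ∃ κ, IsIndexClass F₁ F₂ L κ := ⟨κ, h⟩
  rw [indexBundle, dif_pos hex]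
  exact hu _ hex.choose_spec

end IndexClass

theorem mainTheorem10 {𝕜 : Type u} [RCLike 𝕜]
    {X : Type w} [TopologicalSpace X] [CompactSpace X] [T2Space X]
    {Y : Type u'} [TopologicalSpace Y] [CompactSpace Y] [T2Space Y]
    (F₁ : Type v') [NormedAddCommGroup F₁] [NormedSpace 𝕜 F₁] [CompleteSpace F₁]
    (F₂ : Type w') [NormedAddCommGroup F₂] [NormedSpace 𝕜 F₂] [CompleteSpace F₂]
    {E₁ : X → Type v} [∀ x, AddCommGroup (E₁ x)] [∀ x, Module 𝕜 (E₁ x)]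
    [TopologicalSpace (TotalSpace F₁ E₁)] [∀ x, TopologicalSpace (E₁ x)]
    [FiberBundle F₁ E₁] [VectorBundle 𝕜 F₁ E₁]
    {E₂ : X → Type v} [∀ x, AddCommGroup (E₂ x)] [∀ x, Module 𝕜 (E₂ x)]
    [TopologicalSpace (TotalSpace F₂ E₂)] [∀ x, TopologicalSpace (E₂ x)]
    [FiberBundle F₂ E₂] [VectorBundle 𝕜 F₂ E₂]
    [∀ x, IsTopologicalAddGroup (E₂ x)] [∀ x, ContinuousSMul 𝕜 (E₂ x)]
    (L : ∀ x, E₁ x →L[𝕜] E₂ x) (hL : IsFredholmMorphism F₁ F₂ L) :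
    (∃! κ : KGroup.{u, v, w} 𝕜 X, IsIndexClass F₁ F₂ L κ) ∧
    (∀ f : C(Y, X), indexBundle F₁ F₂ (pullbackMorphism f L) =
      KGroup.pullback f (indexBundle F₁ F₂ L)) ∧
    (∀ f g : C(Y, X), f.Homotopic g →
      indexBundle F₁ F₂ (pullbackMorphism f L) = indexBundle F₁ F₂ (pullbackMorphism g L)) := by

  have hF := QuasiBundle.isFredholmFamily_of_isFredholmMorphism F₁ F₂ L hL
  obtain ⟨κ, hκ⟩ := hF.exists_isFamilyIndex
  have hind : IsIndexClass F₁ F₂ L κ := (isIndexClass_iff F₁ F₂ L κ).2 hκ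
  have huniq : ∀ κ', IsIndexClass F₁ F₂ L κ' → κ' = κ := fun κ' h' =>
    hF.eq_of_isFamilyIndex ((isIndexClass_iff F₁ F₂ L κ').1 h') hκ
  -- `f^* κ` is an index class of `f^* L`, and uniqueness over the compact Hausdorff space `Y` makes
  -- it the index bundle.
  have hpull : ∀ f : C(Y, X),
      indexBundle F₁ F₂ (pullbackMorphism f L) = KGroup.pullback f κ := fun f =>
    indexBundle_eq F₁ F₂ ((isIndexClass_pullbackMorphism_iff F₁ F₂ f L _).2 (hκ.pullback f))
      fun κ' h' => (hF.pullback f.continuous).eq_of_isFamilyIndex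
        ((isIndexClass_pullbackMorphism_iff F₁ F₂ f L κ').1 h') (hκ.pullback f)
  refine ⟨⟨κ, hind, huniq⟩, fun f => ?_, fun f g hfg => ?_⟩
  · rw [hpull, indexBundle_eq F₁ F₂ hind huniq]
  · rw [hpull, hpull, hκ.pullback_eq_of_homotopic hfg]
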